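/- Let $\Bbbk$ be a field, $n\ge 0$ an integer, and $M$ a matroid of rank $\ell$ on the ground set $[n]=\{1,\dots,n\}$ (loops and parallel elements allowed). Let $V=\Bbbk^n$ with standard basis $e_1,\dots,e_n$, let $E=\Lambda(V)$ be its exterior algebra, and let $\partial\colon E\to E$ be the (graded) derivation of degree $-1$ with $\partial(e_i)=1$ for all $i$. The Orlik--Solomon algebra of $M$ is $A=A(M)=E/I$, where $I$ is the two-sided ideal generated by the elements $\partial(e_{i_1}e_{i_2}\cdots e_{i_r})$ for all circuits $\{i_1<\dots<i_r\}$ of $M$; it is graded by the images $A^p$ of $\Lambda^pV$. Let $\overline V=\{v\in\Bbbk^n : \sum_i v_i=0\}$, and let $\overline A=\overline A(M)$ be the subalgebra of $A$ generated by the image of $\overline V$, graded by $\overline A^p=\overline A\cap A^p$. Put $A^p=\overline A^p=0$ for $p<0$. Right multiplication by $v\in V$ (respectively $v\in\overline V$) makes $A$ (respectively $\overline A$) a cochain complex. For integers $p$ and $d\ge 0$ define $$\mathcal R^p_d(A)=\{v\in V : \dim_\Bbbk H^p(A,\cdot v)\ge d\},\qquad \mathcal R^p_d(\overline A)=\{v\in\overline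 V : \dim_\Bbbk H^p(\overline A,\cdot v)\ge d\}\subseteq V,$$ and write $\mathcal R^p=\mathcal R^p_1$. Suppose that $\operatorname{char}\Bbbk$ does not divide $n$ (in characteristic $0$ this means $n\ne 0$). Then: 1. $\mathcal R^p(\overline A)=\mathcal R^p(A)$ for all $0\le p\le \ell-1$. 2. $\mathcal R^{\ell}(A)=\mathcal R^{\ell-1}(A)$. 3. For all integers $p$ and all $d\ge 1$, $$\mathcal R^p_d(A)=\bigcup_{0\le j\le d}\Bigl(\mathcal R^p_j(\overline A)\cap \mathcal R^{p-1}_{d-j}(\overline A)\Bigr).$$ 4. For all integers $p$ and all $d\ge 0$, the same formula holds with the left side replaced by $\mathcal R^p_d(A)\cap\overline V$. (For $d=0$ this intersection is needed: $\mathcal R^p_0(A)=V$, whereas the right side is $\overline V$.) -/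

import Mathlib

open scoped ExteriorAlgebra

/-! ### Cohomology of a graded module with a differential, and resonance varieties -/

section Resonance

variable {k : Type*} [Field k]

/-- A family of subspaces indexed by `ℕ`, extended by zero to negative degrees. -/
def extendByZero {A : Type*} [AddCommGroup A] [Module k A] (G : ℕ → Submodule k A) :
    ℤ → Submodule k A
  | Int.ofNat p => G p
  | Int.negSucc _ => ⊥

/-- The degree `p` cohomology `H^p(A, δ)` of the cochain complex `⋯ → A^p → A^(p+1) → ⋯`, where
`A^p = G p` are the graded pieces of `A` and `δ` is an endomorphism of `A` of degree one and
square zero: cocycles in `A^p` modulo coboundaries of elements of `A^(p-1)`. -/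
abbrev cochainCohomology {A : Type*} [AddCommGroup A] [Module k A] (G : ℤ → Submodule k A)
    (δ : A →ₗ[k] A) (p : ℤ) : Type _ :=
  ↥(G p ⊓ LinearMap.ker δ) ⧸
    ((G (p - 1)).map δ).comap (G p ⊓ LinearMap.ker δ).subtype

/-- The resonance variety `R^p_d(A) = {v ∈ V | dim H^p(A, · v) ≥ d}` of a graded module `A`
on which each `v ∈ V` acts by the endomorphism `act v` (of degree one and square zero). -/
def resonance {V A : Type*} [AddCommGroup V] [Module k V] [AddCommGroup A] [Module k A]
    (G : ℤ → Submodule k A) (act : V →ₗ[k] A →ₗ[k] A) (p : ℤ) (d : ℕ) : Set V :=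
  {v | (d : Cardinal) ≤ Module.rank k (cochainCohomology G (act v) p)}

/-- Given a linear map `φ : V → B` to a `k`-algebra, each `v ∈ V` acts on `B` by
right multiplication by `φ v`. -/
def rightMulAction {V B : Type*} [AddCommGroup V] [Module k V] [Ring B] [Algebra k B]
    (φ : V →ₗ[k] B) : V →ₗ[k] B →ₗ[k] B :=
  (LinearMap.mul k B).flip ∘ₗ φ

end Resonance

/-! ### The Orlik-Solomon algebra and its projective version -/

noncomputable section OrlikSolomon

variable (k : Type*) [Field k] {n : ℕ}

/-- The linear form `v ↦ ∑ i, v i` on `k^n`. -/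
def coordSum (n : ℕ) : Module.Dual k (Fin n → k) :=
  ∑ i, LinearMap.proj i

/-- The derivation `∂` of degree `-1` on the exterior algebra of `k^n`, with `∂ e_i = 1` for all
`i`: it is the contraction with the linear form `coordSum`. -/
def extBoundary (n : ℕ) :
    ExteriorAlgebra k (Fin n → k) →ₗ[k] ExteriorAlgebra k (Fin n → k) :=
  CliffordAlgebra.contractLeft (coordSum k n)

/-- The monomial `e_C`, the product of the `e_i` for `i ∈ C` in increasing order. -/
def extMonomial (C : Finset (Fin n)) : ExteriorAlgebra k (Fin n → k) :=
  ((C.sort (· ≤ ·)).map fun i => ExteriorAlgebra.ι k (Pi.single i (1 : k))).prod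

/-- The Orlik-Solomon ideal, the two-sided ideal generated by `∂ e_C`, `C` a circuit. -/
def osIdeal (M : Matroid (Fin n)) : Ideal (ExteriorAlgebra k (Fin n → k)) :=
  (TwoSidedIdeal.span
    {x | ∃ C : Finset (Fin n), M.IsCircuit ↑C ∧ x = extBoundary k n (extMonomial k C)}).asIdeal

instance (M : Matroid (Fin n)) : (osIdeal k M).IsTwoSided :=
  inferInstanceAs (TwoSidedIdeal.asIdeal _).IsTwoSided

/-- The Orlik-Solomon algebra `A(M) = E / I(M)`. -/
abbrev OSAlgebra (M : Matroid (Fin n)) : Type _ :=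
  ExteriorAlgebra k (Fin n → k) ⧸ osIdeal k M

/-- The natural map `V = k^n → A(M)`. -/
def osι (M : Matroid (Fin n)) : (Fin n → k) →ₗ[k] OSAlgebra k M :=
  (Ideal.Quotient.mkₐ k (osIdeal k M)).toLinearMap ∘ₗ ExteriorAlgebra.ι k

/-- The graded pieces `A^p(M)`, the images of the exterior powers. -/
def osPiece (M : Matroid (Fin n)) (p : ℕ) : Submodule k (OSAlgebra k M) :=
  (⋀[k]^p (Fin n → k)).map (Ideal.Quotient.mkₐ k (osIdeal k M)).toLinearMap

/-- The resonance variety `R^p_d(A(M)) ⊆ V = k^n`. -/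
def osResonance (M : Matroid (Fin n)) (p : ℤ) (d : ℕ) : Set (Fin n → k) :=
  resonance (extendByZero (osPiece k M)) (rightMulAction (osι k M)) p d

/-- The hyperplane `V̄ = {v ∈ k^n | ∑ v_i = 0}`. -/
def sumZero (n : ℕ) : Submodule k (Fin n → k) :=
  LinearMap.ker (coordSum k n)

/-- The projective Orlik-Solomon algebra `Ā(M)`, the subalgebra of `A(M)` generated by `V̄`. -/
def projOS (M : Matroid (Fin n)) : Subalgebra k (OSAlgebra k M) :=
  Algebra.adjoin k (osι k M '' (sumZero k n : Set (Fin n → k)))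

/-- The natural map `V̄ → Ā(M)`. -/
def projOSι (M : Matroid (Fin n)) : sumZero k n →ₗ[k] projOS k M where
  toFun v := ⟨osι k M v, Algebra.subset_adjoin (Set.mem_image_of_mem _ v.2)⟩
  map_add' v w := Subtype.ext (map_add (osι k M) (v : Fin n → k) w)
  map_smul' c v := Subtype.ext (map_smul (osι k M) c (v : Fin n → k))

/-- The graded pieces `Ā^p(M) = Ā(M) ∩ A^p(M)`. -/
def projOSPiece (M : Matroid (Fin n)) (p : ℕ) : Submodule k (projOS k M) :=
  (osPiece k M p).comap (projOS k M).val.toLinearMap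

/-- The resonance variety `R^p_d(Ā(M)) ⊆ V̄`, viewed as a subset of `V = k^n`. -/
def projOSResonance (M : Matroid (Fin n)) (p : ℤ) (d : ℕ) : Set (Fin n → k) :=
  (fun v : sumZero k n => (v : Fin n → k)) ''
    resonance (extendByZero (projOSPiece k M)) (rightMulAction (projOSι k M)) p d

end OrlikSolomon

/-! Let c be the vector with all coordinates 1/n, so ∂c = 1. As ∂ preserves I, it acts on A, and
∂(cx) = x - c∂x gives Ā = ker ∂ and A = Ā ⊕ cĀ (`mem_proj_iff`). For v in V̄, ∂ commutes with right
multiplication by v, so this splits the complex and H^p(A,v) = H^p(Ā,v) ⊕ H^{p-1}(Ā,v)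
(`rank_cochainCohomology`); for v outside V̄, a rescaled ∂ contracts the complex
(`mem_map_of_not_sumZero`). Parts 3 and 4 follow, and so does R^p(A) = R^p(Ā) ∪ R^{p-1}(Ā). Moreover
Ā^ℓ = 0, because multiplication by c embeds it in A^{ℓ+1} = 0. Parts 1 and 2 are thereby reduced to
propagation: R^q(Ā) ⊆ R^{q+1}(Ā) for q + 2 ≤ ℓ.

Propagation (`exists_eq_mul_of_exact_succ`) compares v with the generic vector x = ∑ x_i e_i and its
projection x̄ = ∑ x_i (e_i - c). Suppose H^{q+1}(Ā,v) = 0 and let a ∈ Ā^q with av = 0. A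
Cayley–Hamilton argument (`exists_lift_mulVec_eq_zero`) extends a to a polynomial family F in the
x_i with values in Ā^q, F x̄ = 0 and F(v) = a. Then x(cF) = 0, because x - x̄ is a multiple of c and
c² = 0. Since the complex of x on A is exact in degree q + 1, cF = xG; evaluated at v this reads ca
= v G(v), and applying ∂ gives a = -v ∂G(v), a coboundary in Ā.

Exactness of the generic complex below degree ℓ (`genericExact`) goes by deletion and contraction of
a nonloop n, using 0 → A(M＼n) → A(M) → A(M／n)[-1] → 0, where the second map is the residue along
e_n. Injectivity on the left (`mem_osRelations_delete`) rests on the decomposition of A^p over the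
flats of rank p; exactness in the middle is `exists_sub_mem_osRelations_of_residue`. If n is not a
coloop, the sequence handles ∑_{i≠n} x_i e_i, and the term x_n e_n is put back by recursion on the
power of x_n. If n is a coloop, A(M) = A(M＼n) ⊕ e_n A(M＼n) and a primitive can be written down.
Power series suffice, since only a truncation is evaluated at v. All matroids of the induction share
one exterior algebra: the e_i outside the ground set are imposed as relations (`osRelations`). -/

open scoped ExteriorAlgebra Matroid

/-! ### Monomials, restrictions and contractions in the exterior algebra. -/

noncomputable section ExteriorMonomials

set_option linter.unusedSectionVars false

variable {k : Type*} [Field k] {α : Type*} [Fintype α] [DecidableEq α]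

/-- The basis vector `e_i` in the exterior algebra of `k^α`. -/
def extGen (k : Type*) [Field k] {α : Type*} [DecidableEq α] (i : α) :
    ExteriorAlgebra k (α → k) :=
  ExteriorAlgebra.ι k (Pi.single i (1 : k))

/-- The product of the basis vectors indexed by a list. -/
def listMonomial (k : Type*) [Field k] {α : Type*} [DecidableEq α] (L : List α) :
    ExteriorAlgebra k (α → k) :=
  (L.map (extGen k)).prod

/-- The projection of `k^α` onto the coordinates in `X`. -/
def coordProj (k : Type*) [Field k] {α : Type*} (X : Set α) : (α → k) →ₗ[k] (α → k) where
  toFun v := X.indicator v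
  map_add' v w := Set.indicator_add X v w
  map_smul' c v := Set.indicator_const_smul X c v

/-- The algebra endomorphism of the exterior algebra that kills `e_i` for `i ∉ X`. -/
def extRestrict (k : Type*) [Field k] {α : Type*} (X : Set α) :
    ExteriorAlgebra k (α → k) →ₐ[k] ExteriorAlgebra k (α → k) :=
  ExteriorAlgebra.map (coordProj k X)

/-- The antiderivation with `e_i ↦ 1` for `i ∈ T` and `e_i ↦ 0` for `i ∉ T`. -/
def partialBoundary (k : Type*) [Field k] {α : Type*} [Fintype α] (T : Set α) :
    ExteriorAlgebra k (α → k) →ₗ[k] ExteriorAlgebra k (α → k) :=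
  CliffordAlgebra.contractLeft ((∑ i, LinearMap.proj i) ∘ₗ coordProj k T)

@[simp] lemma listMonomial_nil : listMonomial k ([] : List α) = 1 := rfl

@[simp] lemma listMonomial_cons (i : α) (L : List α) :
    listMonomial k (i :: L) = extGen k i * listMonomial k L := by
  simp [listMonomial]

lemma listMonomial_append (L L' : List α) :
    listMonomial k (L ++ L') = listMonomial k L * listMonomial k L' := by
  simp [listMonomial]

@[simp] lemma extGen_mul_self (i : α) : extGen k i * extGen k i = 0 :=
  ExteriorAlgebra.ι_sq_zero _

@[simp] lemma extGen_mul_self_mul (i : α) (x : ExteriorAlgebra k (α → k)) :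
    extGen k i * (extGen k i * x) = 0 := by
  rw [← mul_assoc, extGen_mul_self, zero_mul]

lemma ι_mul_ι_swap (v w : α → k) :
    ExteriorAlgebra.ι k v * ExteriorAlgebra.ι k w
      = -(ExteriorAlgebra.ι k w * ExteriorAlgebra.ι k v) :=
  eq_neg_of_add_eq_zero_left (ExteriorAlgebra.ι_add_mul_swap v w)

lemma extGen_mul_swap (i j : α) (x : ExteriorAlgebra k (α → k)) :
    extGen k i * (extGen k j * x) = -(extGen k j * (extGen k i * x)) := by
  rw [← mul_assoc, ← mul_assoc, extGen, extGen, ι_mul_ι_swap, neg_mul]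

lemma ι_eq_sum_extGen (v : α → k) :
    ExteriorAlgebra.ι k v = ∑ i, v i • extGen k i := by
  conv_lhs => rw [pi_eq_sum_univ' v]
  simp only [map_sum, map_smul, extGen]

lemma extRestrict_extGen_of_mem {X : Set α} {i : α} (h : i ∈ X) :
    extRestrict k X (extGen k i) = extGen k i := by
  simp only [extRestrict, extGen, ExteriorAlgebra.map_apply_ι]
  congr 1
  ext j
  by_cases hj : j = i
  · subst hj; simp [coordProj, h]
  · simp [coordProj, hj]

lemma extRestrict_extGen_of_notMem {X : Set α} {i : α} (h : i ∉ X) :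
    extRestrict k X (extGen k i) = 0 := by
  simp only [extRestrict, extGen, ExteriorAlgebra.map_apply_ι]
  rw [ExteriorAlgebra.ι_eq_zero_iff]
  ext j
  by_cases hj : j = i
  · subst hj; simp [coordProj, h]
  · simp [coordProj, hj]

lemma partialBoundary_extGen_mul_of_mem {T : Set α} {i : α} (h : i ∈ T)
    (x : ExteriorAlgebra k (α → k)) :
    partialBoundary k T (extGen k i * x) = x - extGen k i * partialBoundary k T x := by
  have : ((∑ i, LinearMap.proj i) ∘ₗ coordProj k T : Module.Dual k (α → k))
      (Pi.single i 1) = 1 := by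
    simp [coordProj]
    rw [Finset.sum_eq_single i] <;> simp +contextual [h]
  rw [partialBoundary, extGen, ExteriorAlgebra.ι, CliffordAlgebra.contractLeft_ι_mul, this,
    one_smul]

lemma partialBoundary_extGen_mul_of_notMem {T : Set α} {i : α} (h : i ∉ T)
    (x : ExteriorAlgebra k (α → k)) :
    partialBoundary k T (extGen k i * x) = -(extGen k i * partialBoundary k T x) := by
  have : ((∑ i, LinearMap.proj i) ∘ₗ coordProj k T : Module.Dual k (α → k))
      (Pi.single i 1) = 0 := by
    simp [coordProj]
    refine Finset.sum_eq_zero fun j _ => ?_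
    by_cases hj : j = i
    · subst hj; simp [h]
    · simp [hj]
  rw [partialBoundary, extGen, ExteriorAlgebra.ι, CliffordAlgebra.contractLeft_ι_mul, this,
    zero_smul, zero_sub]

@[simp] lemma partialBoundary_one (T : Set α) :
    partialBoundary k T (1 : ExteriorAlgebra k (α → k)) = 0 :=
  CliffordAlgebra.contractLeft_one (Q := (0 : QuadraticForm k (α → k))) _

@[simp] lemma partialBoundary_partialBoundary (T : Set α) (x : ExteriorAlgebra k (α → k)) :
    partialBoundary k T (partialBoundary k T x) = 0 :=
  CliffordAlgebra.contractLeft_contractLeft _ _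

lemma ι_mul_mem_of_extGen_mul_mem {K : Submodule k (ExteriorAlgebra k (α → k))}
    (hK : ∀ i, ∀ x ∈ K, extGen k i * x ∈ K) (v : α → k) {x : ExteriorAlgebra k (α → k)}
    (hx : x ∈ K) : ExteriorAlgebra.ι k v * x ∈ K := by
  rw [ι_eq_sum_extGen, Finset.sum_mul]
  refine K.sum_mem fun i _ => ?_
  rw [smul_mul_assoc]
  exact K.smul_mem _ (hK i x hx)

/-- A subspace stable under left multiplication by the generators is a left ideal. -/
lemma mul_mem_of_extGen_mul_mem {K : Submodule k (ExteriorAlgebra k (α → k))}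
    (hK : ∀ i, ∀ x ∈ K, extGen k i * x ∈ K) (y : ExteriorAlgebra k (α → k)) :
    ∀ x ∈ K, y * x ∈ K := by
  induction y using ExteriorAlgebra.induction with
  | algebraMap r => intro x hx; rw [← Algebra.smul_def]; exact K.smul_mem r hx
  | ι v => intro x hx; exact ι_mul_mem_of_extGen_mul_mem hK v hx
  | mul a b ha hb => intro x hx; rw [mul_assoc]; exact ha _ (hb _ hx)
  | add a b ha hb => intro x hx; rw [add_mul]; exact K.add_mem (ha _ hx) (hb _ hx)

lemma mem_of_extGen_mul_mem {K : Submodule k (ExteriorAlgebra k (α → k))} (h1 : 1 ∈ K)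
    (hK : ∀ i, ∀ x ∈ K, extGen k i * x ∈ K) (x : ExteriorAlgebra k (α → k)) : x ∈ K := by
  simpa using mul_mem_of_extGen_mul_mem hK x 1 h1

lemma mem_of_mem_span_of_extGen_mul_mem {K : Submodule k (ExteriorAlgebra k (α → k))}
    {G : Set (ExteriorAlgebra k (α → k))} (hG : G ⊆ K)
    (hK : ∀ i, ∀ x ∈ K, extGen k i * x ∈ K) {x : ExteriorAlgebra k (α → k)}
    (hx : x ∈ Ideal.span G) : x ∈ K := by
  induction hx using Submodule.span_induction with
  | mem x h => exact hG h
  | zero => exact K.zero_mem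
  | add x y _ _ hx hy => exact K.add_mem hx hy
  | smul a x _ hx => exact mul_mem_of_extGen_mul_mem hK a x hx

/-- Two linear maps agree if they agree at `1` and this is preserved by left multiplication by
the generators. -/
lemma linearMap_congr_of_extGen_mul {N : Type*} [AddCommGroup N] [Module k N]
    {f g : ExteriorAlgebra k (α → k) →ₗ[k] N} (h1 : f 1 = g 1)
    (h : ∀ i x, f x = g x → f (extGen k i * x) = g (extGen k i * x))
    (x : ExteriorAlgebra k (α → k)) : f x = g x :=
  mem_of_extGen_mul_mem (K := LinearMap.eqLocus f g) h1 h x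

/-! ### Degrees -/

lemma one_mem_extPow : (1 : ExteriorAlgebra k (α → k)) ∈ ⋀[k]^0 (α → k) := by
  rw [ExteriorAlgebra.exteriorPower, pow_zero]; exact Submodule.one_le.mp le_rfl

lemma ι_mul_mem_extPow (v : α → k) {p : ℕ} {x : ExteriorAlgebra k (α → k)}
    (hx : x ∈ ⋀[k]^p (α → k)) : ExteriorAlgebra.ι k v * x ∈ ⋀[k]^(p + 1) (α → k) := by
  rw [ExteriorAlgebra.exteriorPower, pow_succ']
  exact Submodule.mul_mem_mul (LinearMap.mem_range_self _ _) hx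

lemma extGen_mul_mem_extPow (i : α) {p : ℕ} {x : ExteriorAlgebra k (α → k)}
    (hx : x ∈ ⋀[k]^p (α → k)) : extGen k i * x ∈ ⋀[k]^(p + 1) (α → k) :=
  ι_mul_mem_extPow _ hx

lemma listMonomial_mem_extPow (L : List α) :
    listMonomial k L ∈ ⋀[k]^L.length (α → k) := by
  induction L with
  | nil => exact one_mem_extPow
  | cons i L ih => rw [listMonomial_cons]; exact extGen_mul_mem_extPow i ih

/-- Graded induction: a property of homogeneous elements need only be checked at 1 and under left
multiplication by the generators. -/
lemma extPow_le_of_extGen_mul_mem {K : ℕ → Submodule k (ExteriorAlgebra k (α → k))}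
    (h1 : 1 ∈ K 0) (hK : ∀ p i, ∀ x ∈ K p, extGen k i * x ∈ K (p + 1)) (p : ℕ) :
    ⋀[k]^p (α → k) ≤ K p := by
  intro x hx
  refine Submodule.pow_induction_on_left' (C := fun p x _ => x ∈ K p)
    (LinearMap.range (ExteriorAlgebra.ι k)) ?_ ?_ ?_ hx
  · intro r; rw [Algebra.algebraMap_eq_smul_one]; exact (K 0).smul_mem r h1
  · intro x y i _ _ hx hy; exact (K i).add_mem hx hy
  · rintro m ⟨v, rfl⟩ i x _ hx
    rw [ι_eq_sum_extGen, Finset.sum_mul]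
    refine Submodule.sum_mem _ fun j _ => ?_
    rw [smul_mul_assoc]
    exact Submodule.smul_mem _ _ (hK i j x hx)

lemma extPow_eq_span_listMonomial (p : ℕ) :
    ⋀[k]^p (α → k) = Submodule.span k {x | ∃ L : List α, L.length = p ∧ x = listMonomial k L} := by
  apply le_antisymm
  · refine extPow_le_of_extGen_mul_mem
      (K := fun p => Submodule.span k {x | ∃ L : List α, L.length = p ∧ x = listMonomial k L})
      (Submodule.subset_span ⟨[], rfl, rfl⟩) ?_ p
    intro p i x hx
    induction hx using Submodule.span_induction with
    | mem x h =>
      obtain ⟨L, hL, rfl⟩ := h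
      exact Submodule.subset_span ⟨i :: L, by simp [hL], by simp⟩
    | zero => simp
    | add x y _ _ hx hy => rw [mul_add]; exact Submodule.add_mem _ hx hy
    | smul a x _ hx => rw [mul_smul_comm]; exact Submodule.smul_mem _ a hx
  · rw [Submodule.span_le]
    rintro _ ⟨L, rfl, rfl⟩
    exact listMonomial_mem_extPow L

/-- Homogeneous elements commute with vectors up to a sign. -/
lemma mul_ι_of_mem_extPow (v : α → k) {p : ℕ} {x : ExteriorAlgebra k (α → k)}
    (hx : x ∈ ⋀[k]^p (α → k)) :
    x * ExteriorAlgebra.ι k v = (-1 : k) ^ p • (ExteriorAlgebra.ι k v * x) := by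
  refine extPow_le_of_extGen_mul_mem
    (K := fun p => LinearMap.eqLocus (LinearMap.mulRight k (ExteriorAlgebra.ι k v))
      ((-1 : k) ^ p • LinearMap.mulLeft k (ExteriorAlgebra.ι k v))) ?_ ?_ p hx
  · simp [LinearMap.mem_eqLocus]
  · intro p i x hx
    simp only [LinearMap.mem_eqLocus, LinearMap.mulRight_apply, LinearMap.smul_apply,
      LinearMap.mulLeft_apply] at hx ⊢
    rw [mul_assoc, hx, mul_smul_comm, ← mul_assoc, ← mul_assoc, extGen, ι_mul_ι_swap, neg_mul,
      pow_succ]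
    simp

lemma partialBoundary_mem_extPow (T : Set α) {p : ℕ} {x : ExteriorAlgebra k (α → k)}
    (hx : x ∈ ⋀[k]^p (α → k)) (hp : 1 ≤ p) :
    partialBoundary k T x ∈ ⋀[k]^(p - 1) (α → k) := by
  -- The induction carries membership in degree p along, because ∂(e_i x) contains the term x
  -- itself. Degree 0 is separated since `p - 1` truncates there.
  have key : ∀ p, ⋀[k]^p (α → k) ≤
      (if p = 0 then LinearMap.ker (partialBoundary k T)
        else (⋀[k]^(p - 1) (α → k)).comap (partialBoundary k T)) ⊓ ⋀[k]^p (α → k) := by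
    refine extPow_le_of_extGen_mul_mem ?_ ?_
    · exact ⟨by simp, one_mem_extPow⟩
    · rintro p i x ⟨h1, h2⟩
      refine ⟨?_, extGen_mul_mem_extPow i h2⟩
      have h3 : extGen k i * partialBoundary k T x ∈ ⋀[k]^p (α → k) := by
        by_cases hp : p = 0
        · simp only [hp, if_true, SetLike.mem_coe, LinearMap.mem_ker] at h1
          rw [h1, mul_zero]; exact Submodule.zero_mem _
        · simp only [hp, if_false] at h1
          have := extGen_mul_mem_extPow i (Submodule.mem_comap.mp h1)
          rwa [Nat.sub_add_cancel (Nat.one_le_iff_ne_zero.mpr hp)] at this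
      simp only [Nat.add_eq_zero_iff, one_ne_zero, and_false, if_false, Nat.add_sub_cancel,
        SetLike.mem_coe, Submodule.mem_comap]
      by_cases hi : i ∈ T
      · rw [partialBoundary_extGen_mul_of_mem hi]; exact Submodule.sub_mem _ h2 h3
      · rw [partialBoundary_extGen_mul_of_notMem hi]; exact Submodule.neg_mem _ h3
  have := (key p hx).1
  rw [if_neg (by omega)] at this
  exact this

lemma partialBoundary_eq_zero_of_mem_extPow_zero (T : Set α) {x : ExteriorAlgebra k (α → k)}
    (hx : x ∈ ⋀[k]^0 (α → k)) : partialBoundary k T x = 0 := by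
  rw [extPow_eq_span_listMonomial] at hx
  induction hx using Submodule.span_induction with
  | mem x h =>
    obtain ⟨L, hL, rfl⟩ := h
    rw [List.length_eq_zero_iff.mp hL]; simp
  | zero => simp
  | add x y _ _ hx hy => rw [map_add, hx, hy, add_zero]
  | smul a x _ hx => rw [map_smul, hx, smul_zero]

lemma extRestrict_mem_extPow (X : Set α) {p : ℕ} {x : ExteriorAlgebra k (α → k)}
    (hx : x ∈ ⋀[k]^p (α → k)) : extRestrict k X x ∈ ⋀[k]^p (α → k) := by
  refine extPow_le_of_extGen_mul_mem
    (K := fun p => (⋀[k]^p (α → k)).comap (extRestrict k X).toLinearMap) ?_ ?_ p hx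
  · simp
  · intro p i x hx
    simp only [Submodule.mem_comap, AlgHom.toLinearMap_apply, map_mul] at hx ⊢
    by_cases hi : i ∈ X
    · rw [extRestrict_extGen_of_mem hi]; exact extGen_mul_mem_extPow i hx
    · rw [extRestrict_extGen_of_notMem hi, zero_mul]; exact Submodule.zero_mem _

/-! ### Compatibilities -/

lemma extRestrict_extRestrict (X Y : Set α) (x : ExteriorAlgebra k (α → k)) :
    extRestrict k X (extRestrict k Y x) = extRestrict k (X ∩ Y) x := by
  refine linearMap_congr_of_extGen_mul
    (f := (extRestrict k X).toLinearMap ∘ₗ (extRestrict k Y).toLinearMap)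
    (g := (extRestrict k (X ∩ Y)).toLinearMap) (by simp) (fun i x h => ?_) x
  simp only [LinearMap.comp_apply, AlgHom.toLinearMap_apply, map_mul] at h ⊢
  rw [h]
  by_cases hY : i ∈ Y <;> by_cases hX : i ∈ X <;>
    simp [extRestrict_extGen_of_mem, extRestrict_extGen_of_notMem, hX, hY]

lemma partialBoundary_extRestrict (T X : Set α) (x : ExteriorAlgebra k (α → k)) :
    partialBoundary k T (extRestrict k X x)
      = extRestrict k X (partialBoundary k (T ∩ X) x) := by
  refine linearMap_congr_of_extGen_mul
    (f := partialBoundary k T ∘ₗ (extRestrict k X).toLinearMap)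
    (g := (extRestrict k X).toLinearMap ∘ₗ partialBoundary k (T ∩ X)) (by simp)
    (fun i x h => ?_) x
  simp only [LinearMap.comp_apply, AlgHom.toLinearMap_apply, map_mul] at h ⊢
  by_cases hX : i ∈ X
  · rw [extRestrict_extGen_of_mem hX]
    by_cases hT : i ∈ T
    · rw [partialBoundary_extGen_mul_of_mem hT, partialBoundary_extGen_mul_of_mem (show i ∈ T ∩ X from ⟨hT, hX⟩), h]
      simp [extRestrict_extGen_of_mem hX]
    · rw [partialBoundary_extGen_mul_of_notMem hT,
        partialBoundary_extGen_mul_of_notMem (fun h : i ∈ T ∩ X => hT h.1), h]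
      simp [extRestrict_extGen_of_mem hX]
  · rw [extRestrict_extGen_of_notMem hX, partialBoundary_extGen_mul_of_notMem (fun h : i ∈ T ∩ X => hX h.2)]
    simp [extRestrict_extGen_of_notMem hX]

/-- On elements supported on X only the part of T inside X matters. This is how boundaries for the
ground sets of M, its deletion and its contraction are identified. -/
lemma partialBoundary_congr_of_extRestrict {T T' X : Set α} (h : T ∩ X = T' ∩ X)
    {x : ExteriorAlgebra k (α → k)} (hx : extRestrict k X x = x) :
    partialBoundary k T x = partialBoundary k T' x := by
  rw [← hx, partialBoundary_extRestrict, partialBoundary_extRestrict, h]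

@[simp] lemma partialBoundary_empty (x : ExteriorAlgebra k (α → k)) :
    partialBoundary k (∅ : Set α) x = 0 := by
  refine linearMap_congr_of_extGen_mul (f := partialBoundary k (∅ : Set α)) (g := 0) (by simp)
    (fun i x h => ?_) x
  rw [partialBoundary_extGen_mul_of_notMem (Set.notMem_empty i), h]
  simp

lemma partialBoundary_singleton_eq_zero {n : α} {x : ExteriorAlgebra k (α → k)}
    (hx : extRestrict k {n}ᶜ x = x) : partialBoundary k {n} x = 0 := by
  rw [partialBoundary_congr_of_extRestrict (T' := ∅) (by simp) hx, partialBoundary_empty]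

lemma extRestrict_listMonomial_of_subset {X : Set α} {L : List α} (h : ∀ i ∈ L, i ∈ X) :
    extRestrict k X (listMonomial k L) = listMonomial k L := by
  induction L with
  | nil => simp
  | cons i L ih =>
    simp only [List.mem_cons, forall_eq_or_imp] at h
    rw [listMonomial_cons, map_mul, extRestrict_extGen_of_mem h.1, ih h.2]

lemma extRestrict_listMonomial_of_not_subset {X : Set α} {L : List α}
    (h : ¬ ∀ i ∈ L, i ∈ X) : extRestrict k X (listMonomial k L) = 0 := by
  induction L with
  | nil => simp at h
  | cons i L ih =>
    rw [listMonomial_cons, map_mul]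
    by_cases hi : i ∈ X
    · rw [ih (by simpa [hi] using h), mul_zero]
    · rw [extRestrict_extGen_of_notMem hi, zero_mul]

/-- Every element is `a + e_n b` with `b` the contraction and `a` free of `e_n`. -/
lemma extRestrict_compl_sub (n : α) (x : ExteriorAlgebra k (α → k)) :
    extRestrict k {n}ᶜ x = x - extGen k n * partialBoundary k {n} x := by
  refine linearMap_congr_of_extGen_mul (f := (extRestrict k {n}ᶜ).toLinearMap)
    (g := LinearMap.id - LinearMap.mulLeft k (extGen k n) ∘ₗ partialBoundary k {n}) (by simp)
    (fun i x h => ?_) x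
  simp only [AlgHom.toLinearMap_apply, map_mul, LinearMap.sub_apply, LinearMap.id_apply,
    LinearMap.comp_apply, LinearMap.mulLeft_apply] at h ⊢
  by_cases hi : i = n
  · subst hi
    rw [extRestrict_extGen_of_notMem (by simp), partialBoundary_extGen_mul_of_mem (by simp)]
    simp [mul_sub]
  · rw [extRestrict_extGen_of_mem (by simpa using hi),
      partialBoundary_extGen_mul_of_notMem (by simpa using hi), h, mul_sub, mul_neg,
      extGen_mul_swap i n]

lemma extRestrict_compl_partialBoundary (n : α) (x : ExteriorAlgebra k (α → k)) :
    extRestrict k {n}ᶜ (partialBoundary k {n} x) = partialBoundary k {n} x := by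
  rw [extRestrict_compl_sub, partialBoundary_partialBoundary, mul_zero, sub_zero]

/-- Permuting the factors changes a monomial by a sign. -/
lemma listMonomial_perm {L L' : List α} (h : L.Perm L') :
    listMonomial k L = listMonomial k L' ∨ listMonomial k L = -listMonomial k L' := by
  induction h with
  | nil => simp
  | cons i _ ih => rcases ih with h | h <;> simp [h]
  | swap i j L => right; simp only [listMonomial_cons]; exact extGen_mul_swap _ _ _
  | trans _ _ h1 h2 => rcases h1 with h1 | h1 <;> rcases h2 with h2 | h2 <;> simp [h1, h2]

lemma listMonomial_eq_zero_of_not_nodup {L : List α} (h : ¬ L.Nodup) :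
    listMonomial k L = 0 := by
  induction L with
  | nil => simp at h
  | cons i L ih =>
    rw [List.nodup_cons, not_and_or, not_not] at h
    by_cases hi : i ∈ L
    · rcases listMonomial_perm (k := k) (List.perm_cons_erase hi) with h' | h' <;>
        simp [h']
    · rw [listMonomial_cons, ih (h.resolve_left hi), mul_zero]

end ExteriorMonomials

/-! ### The ideal of relations, and its behaviour under flats, deletion and contraction. -/

noncomputable section OrlikSolomonRelations

set_option linter.unusedSectionVars false

variable {k : Type*} [Field k] {α : Type*} [Fintype α] [DecidableEq α]

/-! ### Homogeneous components -/

/-- The degree `p` component of an element of the exterior algebra. -/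
def extComponent (k : Type*) [Field k] (α : Type*) (p : ℕ) :
    ExteriorAlgebra k (α → k) →ₗ[k] ExteriorAlgebra k (α → k) :=
  GradedAlgebra.proj (fun i : ℕ => ⋀[k]^i (α → k)) p

lemma extComponent_mem (p : ℕ) (x : ExteriorAlgebra k (α → k)) :
    extComponent k α p x ∈ ⋀[k]^p (α → k) :=
  SetLike.coe_mem _

lemma extComponent_of_mem {p : ℕ} {x : ExteriorAlgebra k (α → k)} (hx : x ∈ ⋀[k]^p (α → k)) :
    extComponent k α p x = x :=
  DirectSum.decompose_of_mem_same (fun i : ℕ => ⋀[k]^i (α → k)) hx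

lemma extComponent_of_mem_ne {p q : ℕ} {x : ExteriorAlgebra k (α → k)}
    (hx : x ∈ ⋀[k]^p (α → k)) (h : p ≠ q) : extComponent k α q x = 0 :=
  DirectSum.decompose_of_mem_ne (fun i : ℕ => ⋀[k]^i (α → k)) hx h

lemma extGen_mem_extPow (i : α) : extGen k i ∈ ⋀[k]^1 (α → k) := by
  simpa using extGen_mul_mem_extPow i (one_mem_extPow (k := k))

lemma extComponent_succ_extGen_mul (p : ℕ) (i : α) (x : ExteriorAlgebra k (α → k)) :
    extComponent k α (p + 1) (extGen k i * x) = extGen k i * extComponent k α p x := by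
  rw [add_comm]
  exact DirectSum.coe_decompose_mul_add_of_left_mem (fun i : ℕ => ⋀[k]^i (α → k))
    (extGen_mem_extPow i)

lemma extComponent_zero_extGen_mul (i : α) (x : ExteriorAlgebra k (α → k)) :
    extComponent k α 0 (extGen k i * x) = 0 :=
  DirectSum.coe_decompose_mul_of_left_mem_of_not_le (fun i : ℕ => ⋀[k]^i (α → k))
    (extGen_mem_extPow i) (by norm_num)

lemma extRestrict_extComponent (X : Set α) (p : ℕ) (x : ExteriorAlgebra k (α → k)) :
    extRestrict k X (extComponent k α p x) = extComponent k α p (extRestrict k X x) := by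
  have : x ∈ ⨅ p, LinearMap.eqLocus ((extRestrict k X).toLinearMap ∘ₗ extComponent k α p)
      (extComponent k α p ∘ₗ (extRestrict k X).toLinearMap) := by
    refine mem_of_extGen_mul_mem ?_ ?_ x
    · simp only [Submodule.mem_iInf, LinearMap.mem_eqLocus, LinearMap.comp_apply,
        AlgHom.toLinearMap_apply, map_one]
      intro p
      by_cases hp : 0 = p
      · subst hp; rw [extComponent_of_mem one_mem_extPow, map_one]
      · rw [extComponent_of_mem_ne one_mem_extPow hp, map_zero]
    · intro i x hx
      simp only [Submodule.mem_iInf, LinearMap.mem_eqLocus, LinearMap.comp_apply,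
        AlgHom.toLinearMap_apply, map_mul] at hx ⊢
      intro p
      by_cases hi : i ∈ X
      · rw [extRestrict_extGen_of_mem hi]
        cases p with
        | zero => simp [extComponent_zero_extGen_mul]
        | succ p => rw [extComponent_succ_extGen_mul, extComponent_succ_extGen_mul, map_mul, hx,
            extRestrict_extGen_of_mem hi]
      · rw [extRestrict_extGen_of_notMem hi]
        cases p with
        | zero => simp [extComponent_zero_extGen_mul]
        | succ p => simp [extComponent_succ_extGen_mul, extRestrict_extGen_of_notMem hi]
  rw [Submodule.mem_iInf] at this
  exact this p

/-! ### The relations -/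

/-- The left ideal of the exterior algebra of `k^α` generated by the `e_i` outside the ground set
of `M` and by the boundaries of the dependent monomials. -/
def osRelations (k : Type*) [Field k] {α : Type*} [Fintype α] [DecidableEq α] (M : Matroid α) :
    Ideal (ExteriorAlgebra k (α → k)) :=
  Ideal.span ({x | ∃ i ∉ M.E, x = extGen k i} ∪
    {x | ∃ L : List α, L.Nodup ∧ M.Dep {i | i ∈ L} ∧
      x = partialBoundary k M.E (listMonomial k L)})

variable {M : Matroid α}

lemma extGen_mem_osRelations {i : α} (h : i ∉ M.E) : extGen k i ∈ osRelations k M :=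
  Ideal.subset_span (Or.inl ⟨i, h, rfl⟩)

lemma partialBoundary_listMonomial_mem_osRelations {L : List α} (hL : L.Nodup)
    (hd : M.Dep {i | i ∈ L}) :
    partialBoundary k M.E (listMonomial k L) ∈ osRelations k M :=
  Ideal.subset_span (Or.inr ⟨L, hL, hd, rfl⟩)

lemma smul_mem_osRelations (c : k) {x : ExteriorAlgebra k (α → k)} (hx : x ∈ osRelations k M) :
    c • x ∈ osRelations k M :=
  ((osRelations k M).restrictScalars k).smul_mem c hx

/-- Induction principle for the ideal of relations. -/
lemma osRelations_le {K : Submodule k (ExteriorAlgebra k (α → k))}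
    (h1 : ∀ i, i ∉ M.E → extGen k i ∈ K)
    (h2 : ∀ L : List α, L.Nodup → M.Dep {i | i ∈ L} →
      partialBoundary k M.E (listMonomial k L) ∈ K)
    (hK : ∀ i, ∀ x ∈ K, extGen k i * x ∈ K) {x : ExteriorAlgebra k (α → k)}
    (hx : x ∈ osRelations k M) : x ∈ K := by
  refine mem_of_mem_span_of_extGen_mul_mem ?_ hK hx
  rintro _ (⟨i, hi, rfl⟩ | ⟨L, hL, hd, rfl⟩)
  · exact h1 i hi
  · exact h2 L hL hd

lemma mem_osRelations_of_perm {L L' : List α} (h : L.Perm L')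
    (hL : listMonomial k L' ∈ osRelations k M) : listMonomial k L ∈ osRelations k M := by
  rcases listMonomial_perm (k := k) h with h | h <;> rw [h]
  · exact hL
  · exact neg_mem hL

/-- If e_c e_L is a dependent monomial, then e_c ∂(e_c e_L) = e_c e_L, so the monomial lies in the
ideal along with its boundary. -/
lemma listMonomial_mem_osRelations {L : List α} (h : ¬ M.Indep {i | i ∈ L}) :
    listMonomial k L ∈ osRelations k M := by
  by_cases hL : L.Nodup
  swap
  · rw [listMonomial_eq_zero_of_not_nodup hL]; exact zero_mem _
  by_cases hE : ∀ i ∈ L, i ∈ M.E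
  · have hd : M.Dep {i | i ∈ L} := ⟨h, hE⟩
    cases L with
    | nil => simp at h
    | cons c L =>
      have := (osRelations k M).mul_mem_left (extGen k c)
        (partialBoundary_listMonomial_mem_osRelations hL hd)
      rw [listMonomial_cons, partialBoundary_extGen_mul_of_mem (hE c (by simp))] at this
      simpa [mul_sub] using this
  · push Not at hE
    obtain ⟨i, hi, hiE⟩ := hE
    refine mem_osRelations_of_perm ((List.perm_cons_erase hi).trans
      (List.perm_append_singleton i _).symm) ?_
    rw [listMonomial_append]
    refine (osRelations k M).mul_mem_left _ ?_
    simpa using extGen_mem_osRelations hiE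

/-- The boundary of e_i is 1, so a loop collapses the whole algebra. -/
lemma one_mem_osRelations_of_isLoop {i : α} (h : M.IsLoop i) : 1 ∈ osRelations k M := by
  have := partialBoundary_listMonomial_mem_osRelations (k := k) (M := M) (L := [i]) (by simp)
    (by simpa using h)
  rw [listMonomial_cons, partialBoundary_extGen_mul_of_mem h.mem_ground] at this
  simpa using this

lemma partialBoundary_mem_osRelations {x : ExteriorAlgebra k (α → k)}
    (hx : x ∈ osRelations k M) : partialBoundary k M.E x ∈ osRelations k M := by
  suffices x ∈ (osRelations k M).restrictScalars k ⊓
      ((osRelations k M).restrictScalars k).comap (partialBoundary k M.E) from this.2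
  refine osRelations_le ?_ ?_ ?_ hx
  · intro i hi
    refine ⟨extGen_mem_osRelations hi, ?_⟩
    have := partialBoundary_extGen_mul_of_notMem (k := k) hi 1
    simp at this
    simp [this]
  · intro L hL hd
    refine ⟨partialBoundary_listMonomial_mem_osRelations hL hd, ?_⟩
    simp
  · rintro i x ⟨h1, h2⟩
    refine ⟨(osRelations k M).mul_mem_left _ h1, ?_⟩
    have h3 := (osRelations k M).mul_mem_left (extGen k i) h2
    by_cases hi : i ∈ M.E
    · simp only [SetLike.mem_coe, Submodule.mem_comap, partialBoundary_extGen_mul_of_mem hi]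
      exact sub_mem h1 h3
    · simp only [SetLike.mem_coe, Submodule.mem_comap, partialBoundary_extGen_mul_of_notMem hi]
      exact neg_mem h3

/-- The generators are homogeneous, hence so is the ideal. -/
lemma extComponent_mem_osRelations (p : ℕ) {x : ExteriorAlgebra k (α → k)}
    (hx : x ∈ osRelations k M) : extComponent k α p x ∈ osRelations k M := by
  suffices x ∈ ⨅ p, ((osRelations k M).restrictScalars k).comap (extComponent k α p) from
    (Submodule.mem_iInf _).mp this p
  have hom : ∀ {q : ℕ} {x : ExteriorAlgebra k (α → k)}, x ∈ ⋀[k]^q (α → k) →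
      x ∈ osRelations k M →
      x ∈ ⨅ p, ((osRelations k M).restrictScalars k).comap (extComponent k α p) := by
    intro q x hq hx
    rw [Submodule.mem_iInf]
    intro p
    by_cases h : q = p
    · subst h; simpa [extComponent_of_mem hq] using hx
    · simp [extComponent_of_mem_ne hq h]
  refine osRelations_le (fun i hi => hom (extGen_mem_extPow i) (extGen_mem_osRelations hi))
    (fun L hL hd => hom (partialBoundary_mem_extPow _ (listMonomial_mem_extPow L) ?_)
      (partialBoundary_listMonomial_mem_osRelations hL hd)) ?_ hx
  · cases L with
    | nil => exact absurd hd.not_indep (by simp)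
    | cons => simp
  · intro i x hx
    simp only [Submodule.mem_iInf, Submodule.mem_comap, Submodule.restrictScalars_mem] at hx ⊢
    intro p
    cases p with
    | zero => simp [extComponent_zero_extGen_mul]
    | succ p =>
      rw [extComponent_succ_extGen_mul]
      exact (osRelations k M).mul_mem_left _ (hx p)

lemma partialBoundary_eq_or_neg_of_perm (T : Set α) {L L' : List α} (h : L.Perm L') :
    partialBoundary k T (listMonomial k L) = partialBoundary k T (listMonomial k L') ∨
    partialBoundary k T (listMonomial k L) = -partialBoundary k T (listMonomial k L') := by
  rcases listMonomial_perm (k := k) h with h | h <;> rw [h] <;> simp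

/-- Flatness matters when a dependent set L has exactly one element i outside X: ∂e_L then restricts
to ± e_{L∖i}. If L∖i were independent, then i, lying outside the closure of L∖i, would make L
independent; so e_{L∖i} is a relation. -/
lemma extRestrict_mem_osRelations {X : Set α} (hX : M.IsFlat X)
    {x : ExteriorAlgebra k (α → k)} (hx : x ∈ osRelations k M) :
    extRestrict k X x ∈ osRelations k M := by
  suffices x ∈ ((osRelations k M).restrictScalars k).comap (extRestrict k X).toLinearMap from this
  refine osRelations_le ?_ ?_ ?_ hx
  · intro i hi
    have : i ∉ X := fun h => hi (hX.subset_ground h)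
    simp [extRestrict_extGen_of_notMem this]
  · intro L hL hd
    simp only [Submodule.mem_comap, AlgHom.toLinearMap_apply, Submodule.restrictScalars_mem]
    by_cases hLX : ∀ i ∈ L, i ∈ X
    · have h1 := extRestrict_listMonomial_of_subset (k := k) hLX
      have h2 : extRestrict k X (partialBoundary k (M.E ∩ X) (listMonomial k L))
          = partialBoundary k M.E (listMonomial k L) := by
        rw [← partialBoundary_extRestrict, h1]
      rw [partialBoundary_congr_of_extRestrict (T' := M.E ∩ X) (X := X) (by simp) h1, h2]
      exact partialBoundary_listMonomial_mem_osRelations hL hd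
    · push Not at hLX
      obtain ⟨i, hi, hiX⟩ := hLX
      have hp := List.perm_cons_erase hi
      suffices extRestrict k X (partialBoundary k M.E (listMonomial k (i :: L.erase i)))
          ∈ osRelations k M by
        rcases partialBoundary_eq_or_neg_of_perm (k := k) M.E hp with h | h <;> rw [h]
        · exact this
        · rw [map_neg]; exact neg_mem this
      have hiE : i ∈ M.E := hd.subset_ground hi
      rw [listMonomial_cons, partialBoundary_extGen_mul_of_mem hiE, map_sub, map_mul,
        extRestrict_extGen_of_notMem hiX, zero_mul, sub_zero]
      by_cases hL' : ∀ j ∈ L.erase i, j ∈ X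
      · rw [extRestrict_listMonomial_of_subset hL']
        refine listMonomial_mem_osRelations fun hI => hd.not_indep ?_
        have : {j | j ∈ L} = insert i {j | j ∈ L.erase i} := by
          ext j; simp [hp.mem_iff]
        rw [this, hI.insert_indep_iff]
        left
        refine ⟨hiE, fun hcl => hiX ?_⟩
        rw [← hX.closure]
        exact M.closure_subset_closure hL' hcl
      · rw [extRestrict_listMonomial_of_not_subset hL']; exact zero_mem _
  · intro i x hx
    simp only [Submodule.mem_comap, AlgHom.toLinearMap_apply, Submodule.restrictScalars_mem,
      map_mul] at hx ⊢
    exact (osRelations k M).mul_mem_left _ hx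

lemma encard_setOf_mem_list {L : List α} (hL : L.Nodup) : {i | i ∈ L}.encard = L.length := by
  have : {i | i ∈ L} = (L.toFinset : Set α) := by ext; simp
  rw [this, Set.encard_coe_eq_coe_finsetCard, List.toFinset_card_of_nodup hL]

/-- Elements of degree larger than the rank of `X` restrict to relations on `X`. -/
lemma extRestrict_mem_osRelations_of_eRk_lt {X : Set α} {p : ℕ} (hX : M.eRk X < p)
    {x : ExteriorAlgebra k (α → k)} (hx : x ∈ ⋀[k]^p (α → k)) :
    extRestrict k X x ∈ osRelations k M := by
  rw [extPow_eq_span_listMonomial] at hx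
  induction hx using Submodule.span_induction with
  | mem x h =>
    obtain ⟨L, hL, rfl⟩ := h
    by_cases hLX : ∀ i ∈ L, i ∈ X
    · rw [extRestrict_listMonomial_of_subset hLX]
      by_cases hn : L.Nodup
      · refine listMonomial_mem_osRelations fun hI => ?_
        have := hI.encard_le_eRk_of_subset hLX
        rw [encard_setOf_mem_list hn, hL] at this
        exact absurd hX (not_lt.mpr this)
      · rw [listMonomial_eq_zero_of_not_nodup hn]; exact zero_mem _
    · rw [extRestrict_listMonomial_of_not_subset hLX]; exact zero_mem _
  | zero => simp
  | add x y _ _ hx hy => rw [map_add]; exact add_mem hx hy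
  | smul a x _ hx => rw [map_smul]; exact smul_mem_osRelations a hx

/-- For j in X, e_j x has degree above the rank of X and so is a relation; its boundary is x - e_j
∂x. Thus ∂ is injective modulo relations on the top degree of a set of positive rank. -/
lemma mem_osRelations_of_partialBoundary_mem {X : Set α} {p : ℕ} (hX : M.eRk X = p)
    (hp : p ≠ 0) {x : ExteriorAlgebra k (α → k)} (hx : x ∈ ⋀[k]^p (α → k))
    (hxX : extRestrict k X x = x) (hd : partialBoundary k M.E x ∈ osRelations k M) :
    x ∈ osRelations k M := by
  obtain ⟨j, hjX, hjE⟩ : (X ∩ M.E).Nonempty := by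
    rw [Set.nonempty_iff_ne_empty]
    intro h
    rw [← M.eRk_inter_ground, h, M.eRk_empty] at hX
    exact hp (by exact_mod_cast hX.symm)
  have h1 : extGen k j * x ∈ osRelations k M := by
    have : extRestrict k X (extGen k j * x) = extGen k j * x := by
      rw [map_mul, extRestrict_extGen_of_mem hjX, hxX]
    rw [← this]
    refine extRestrict_mem_osRelations_of_eRk_lt (p := p + 1) ?_ (extGen_mul_mem_extPow j hx)
    rw [hX]; exact_mod_cast Nat.lt_succ_self p
  have h2 := partialBoundary_mem_osRelations h1
  rw [partialBoundary_extGen_mul_of_mem hjE] at h2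
  simpa using add_mem h2 ((osRelations k M).mul_mem_left (extGen k j) hd)

/-! ### Brieskorn decomposition over flats. -/

/-- The set of flats of rank `p`. -/
def flatsOfRank (M : Matroid α) (p : ℕ) : Finset (Set α) :=
  (Set.toFinite {X : Set α | M.IsFlat X ∧ M.eRk X = p}).toFinset

lemma mem_flatsOfRank {p : ℕ} {X : Set α} :
    X ∈ flatsOfRank M p ↔ M.IsFlat X ∧ M.eRk X = p := by
  simp [flatsOfRank]

/-- Modulo the relations, an element of degree `p` is the sum of its components in the flats of
rank `p`. -/
lemma sub_sum_extRestrict_mem_osRelations {p : ℕ} {x : ExteriorAlgebra k (α → k)}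
    (hx : x ∈ ⋀[k]^p (α → k)) :
    x - ∑ X ∈ flatsOfRank M p, extRestrict k X x ∈ osRelations k M := by
  rw [extPow_eq_span_listMonomial] at hx
  induction hx using Submodule.span_induction with
  | mem x h =>
    obtain ⟨L, hL, rfl⟩ := h
    by_cases hI : M.Indep {i | i ∈ L} ∧ L.Nodup
    · obtain ⟨hI, hn⟩ := hI
      have hcard : M.eRk {i | i ∈ L} = p := by
        rw [hI.eRk_eq_encard, encard_setOf_mem_list hn, hL]
      have hsub : {i | i ∈ L} ⊆ M.closure {i | i ∈ L} := M.subset_closure _ hI.subset_ground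
      -- An independent monomial of degree p survives restriction to exactly one flat of rank p, its
      -- closure.
      rw [Finset.sum_eq_single (M.closure {i | i ∈ L})]
      · rw [extRestrict_listMonomial_of_subset hsub, sub_self]; exact zero_mem _
      · intro X hX hne
        rw [mem_flatsOfRank] at hX
        refine extRestrict_listMonomial_of_not_subset fun hLX => hne ?_
        have hb : M.IsBasis {i | i ∈ L} X :=
          hI.isBasis_of_eRk_ge (List.finite_toSet L) hLX (by rw [hX.2, hcard]) hX.1.subset_ground
        rw [hb.closure_eq_closure, hX.1.closure]
      · intro h
        refine absurd (mem_flatsOfRank.mpr ⟨M.isFlat_closure _, ?_⟩) h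
        rw [M.eRk_closure_eq, hcard]
    · have hz : listMonomial k L ∈ osRelations k M := by
        by_cases hn : L.Nodup
        · exact listMonomial_mem_osRelations fun h => hI ⟨h, hn⟩
        · rw [listMonomial_eq_zero_of_not_nodup hn]; exact zero_mem _
      refine sub_mem hz (sum_mem fun X hX => ?_)
      exact extRestrict_mem_osRelations (mem_flatsOfRank.mp hX).1 hz
  | zero => simp
  | add x y _ _ hx hy =>
    simp only [map_add, Finset.sum_add_distrib]
    rw [add_sub_add_comm]
    exact add_mem hx hy
  | smul a x _ hx =>
    simp only [map_smul, ← Finset.smul_sum]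
    rw [← smul_sub]
    exact smul_mem_osRelations a hx

/-! ### Deletion -/

/-- Without loops, every generator has positive degree, so the augmentation kills the ideal. This
starts the degree induction for deletions. -/
lemma eq_zero_of_mem_osRelations_of_loopless (hM : ∀ i, ¬ M.IsLoop i)
    {x : ExteriorAlgebra k (α → k)} (hx : x ∈ osRelations k M) :
    ExteriorAlgebra.algebraMapInv x = (0 : k) := by
  have hg : ∀ i : α, ExteriorAlgebra.algebraMapInv (extGen k i) = (0 : k) := by
    intro i; simp [ExteriorAlgebra.algebraMapInv, extGen]
  suffices x ∈ LinearMap.ker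
    (ExteriorAlgebra.algebraMapInv (R := k) (M := α → k)).toLinearMap from this
  refine osRelations_le ?_ ?_ ?_ hx
  · intro i _; simp [hg]
  · intro L hL hd
    match L with
    | [] => exact absurd hd.not_indep (by simp)
    | [i] => exact absurd (by simpa using hd) (hM i)
    | i :: j :: L =>
      rw [listMonomial_cons, partialBoundary_extGen_mul_of_mem (hd.subset_ground (by simp))]
      simp [hg]
  · intro i x _; simp [hg]

lemma extRestrict_partialBoundary_of_extRestrict {T X : Set α} {x : ExteriorAlgebra k (α → k)}
    (hx : extRestrict k X x = x) :
    extRestrict k X (partialBoundary k T x) = partialBoundary k T x := by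
  conv_rhs => rw [← hx, partialBoundary_extRestrict]
  rw [partialBoundary_congr_of_extRestrict (T' := T ∩ X) (by simp) hx]

/-- The Orlik-Solomon algebra of a deletion embeds into that of the matroid. -/
theorem mem_osRelations_delete {n : α} (hn : M.IsNonloop n) {p : ℕ}
    {x : ExteriorAlgebra k (α → k)} (hp : x ∈ ⋀[k]^p (α → k))
    (hx : extRestrict k {n}ᶜ x = x) (hxM : x ∈ osRelations k M) :
    x ∈ osRelations k (M ＼ {n}) := by
  induction p generalizing x with
  | zero =>
    by_cases hM : ∃ i, M.IsLoop i
    · obtain ⟨i, hi⟩ := hM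
      have hin : i ≠ n := by rintro rfl; exact hn.not_isLoop hi
      have hl : (M ＼ {n}).IsLoop i := by
        rw [← Matroid.singleton_dep, Matroid.delete_dep_iff]
        simpa using ⟨hi, hin⟩
      rw [(Ideal.eq_top_iff_one _).mpr (one_mem_osRelations_of_isLoop hl)]
      trivial
    · push Not at hM
      have h0 := eq_zero_of_mem_osRelations_of_loopless hM hxM
      rw [ExteriorAlgebra.exteriorPower, pow_zero] at hp
      obtain ⟨c, rfl⟩ := Submodule.mem_one.mp hp
      rw [ExteriorAlgebra.algebraMap_leftInverse] at h0
      simp [h0]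
  | succ p ih =>
    -- Decomposing over the flats of the deletion reduces to an element supported on one flat X,
    -- where membership can be tested on the boundary, one degree lower.
    suffices ∀ X ∈ flatsOfRank (M ＼ {n}) (p + 1),
        extRestrict k X x ∈ osRelations k (M ＼ {n}) by
      have h := sub_sum_extRestrict_mem_osRelations (M := M ＼ {n}) hp
      simpa using add_mem h (sum_mem this)
    intro X hX
    rw [mem_flatsOfRank] at hX
    have hXE := hX.1.subset_ground
    rw [Matroid.delete_ground] at hXE
    have hnX : n ∉ X := fun h => (hXE h).2 rfl
    -- X is the trace of a flat of M. On elements free of e_n, restricting to X is therefore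
    -- restricting to that flat, which preserves the relations of M.
    have hcl : M.closure X ∩ {n}ᶜ = X := by
      have := hX.1.closure
      rwa [Matroid.delete_closure_eq, Set.sdiff_singleton_eq_self hnX] at this
    have hXn : X ∩ {n}ᶜ = X := by
      rw [Set.inter_eq_left]; intro i hi; rintro rfl; exact hnX hi
    have hxX : extRestrict k X x = extRestrict k (M.closure X) x := by
      conv_rhs => rw [← hx, extRestrict_extRestrict, hcl]
    have hyM : extRestrict k X x ∈ osRelations k M := by
      rw [hxX]; exact extRestrict_mem_osRelations (M.isFlat_closure _) hxM
    have hyn : extRestrict k {n}ᶜ (extRestrict k X x) = extRestrict k X x := by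
      rw [extRestrict_extRestrict, Set.inter_comm, hXn]
    have hyd : partialBoundary k (M ＼ {n}).E (extRestrict k X x)
        = partialBoundary k M.E (extRestrict k X x) := by
      refine partialBoundary_congr_of_extRestrict (X := {n}ᶜ) ?_ hyn
      ext; simp
    refine mem_osRelations_of_partialBoundary_mem hX.2 (Nat.succ_ne_zero p)
      (extRestrict_mem_extPow X hp) (by rw [extRestrict_extRestrict, Set.inter_self]) ?_
    rw [hyd]
    refine ih (partialBoundary_mem_extPow _ (extRestrict_mem_extPow X hp) (by omega))
      (extRestrict_partialBoundary_of_extRestrict hyn) (partialBoundary_mem_osRelations hyM)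

/-- The restriction is needed because e_n is a relation of the deletion but in general not of M; all
other generators pass to M. -/
lemma extRestrict_mem_of_mem_osRelations_delete {n : α} {x : ExteriorAlgebra k (α → k)}
    (hx : x ∈ osRelations k (M ＼ {n})) : extRestrict k {n}ᶜ x ∈ osRelations k M := by
  suffices x ∈ ((osRelations k M).restrictScalars k).comap (extRestrict k {n}ᶜ).toLinearMap
    from this
  refine osRelations_le ?_ ?_ ?_ hx
  · intro i hi
    simp only [Submodule.mem_comap, AlgHom.toLinearMap_apply, Submodule.restrictScalars_mem]
    by_cases hin : i = n
    · subst hin; rw [extRestrict_extGen_of_notMem (by simp)]; exact zero_mem _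
    · rw [extRestrict_extGen_of_mem (by simpa using hin)]
      exact extGen_mem_osRelations fun h => hi ⟨h, hin⟩
  · intro L hL hd
    rw [Matroid.delete_dep_iff] at hd
    have hLn : extRestrict k {n}ᶜ (listMonomial k L) = listMonomial k L :=
      extRestrict_listMonomial_of_subset fun i hi => by
        rintro rfl; exact Set.disjoint_left.mp hd.2 hi rfl
    simp only [Submodule.mem_comap, AlgHom.toLinearMap_apply, Submodule.restrictScalars_mem]
    rw [extRestrict_partialBoundary_of_extRestrict hLn,
      partialBoundary_congr_of_extRestrict (T' := M.E) (X := {n}ᶜ) (by ext; simp) hLn]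
    exact partialBoundary_listMonomial_mem_osRelations hL hd.1
  · intro i x hx
    simp only [Submodule.mem_comap, AlgHom.toLinearMap_apply, Submodule.restrictScalars_mem,
      map_mul] at hx ⊢
    exact (osRelations k M).mul_mem_left _ hx

/-! ### Contraction -/

/-- This makes the residue along n a well-defined map from A(M) to A(M／n). The first half is needed
in the induction, because the residue of e_n x involves x itself. -/
lemma mem_osRelations_contract {n : α} (hn : M.IsNonloop n) {x : ExteriorAlgebra k (α → k)}
    (hx : x ∈ osRelations k M) :
    x ∈ osRelations k (M ／ {n}) ∧ partialBoundary k {n} x ∈ osRelations k (M ／ {n}) := by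
  have hnE := hn.mem_ground
  have hgr : (M ／ {n}).E = M.E \ {n} := rfl
  -- This serves a dependent set avoiding n and also a dependent set containing n, once n is
  -- removed: in both cases what remains is not independent in M／n.
  have hdep : ∀ L : List α, n ∉ L → ¬ M.Indep (insert n {i | i ∈ L}) →
      listMonomial k L ∈ osRelations k (M ／ {n}) ∧
      partialBoundary k M.E (listMonomial k L) ∈ osRelations k (M ／ {n}) ∧
      partialBoundary k {n} (listMonomial k L) = 0 ∧
      partialBoundary k {n} (partialBoundary k M.E (listMonomial k L)) = 0 := by
    intro L hnL hL
    have h1 : listMonomial k L ∈ osRelations k (M ／ {n}) :=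
      listMonomial_mem_osRelations fun h => hL (hn.contractElem_indep_iff.mp h).2
    have hr : extRestrict k {n}ᶜ (listMonomial k L) = listMonomial k L :=
      extRestrict_listMonomial_of_subset fun i hi => by rintro rfl; exact hnL hi
    refine ⟨h1, ?_, partialBoundary_singleton_eq_zero hr,
      partialBoundary_singleton_eq_zero (extRestrict_partialBoundary_of_extRestrict hr)⟩
    rw [partialBoundary_congr_of_extRestrict (T' := (M ／ {n}).E) (X := {n}ᶜ)
      (by rw [hgr]; ext; simp) hr]
    exact partialBoundary_mem_osRelations h1
  suffices x ∈ (osRelations k (M ／ {n})).restrictScalars k ⊓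
      ((osRelations k (M ／ {n})).restrictScalars k).comap (partialBoundary k {n}) from this
  refine osRelations_le ?_ ?_ ?_ hx
  · intro i hi
    have hin : i ≠ n := by rintro rfl; exact hi hnE
    refine ⟨extGen_mem_osRelations fun h => hi h.1, ?_⟩
    have := partialBoundary_extGen_mul_of_notMem (k := k) (T := {n}) (i := i) (by simpa) 1
    simp at this
    simp [this]
  · intro L hL hd
    by_cases hnL : n ∈ L
    · have hp := List.perm_cons_erase hnL
      have hset : {i | i ∈ L} = insert n {i | i ∈ L.erase n} := by
        ext j; simp [hp.mem_iff]
      obtain ⟨h1, h2, h3, h4⟩ := hdep (L.erase n) (fun h => (hL.mem_erase_iff.mp h).1 rfl)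
        (hset ▸ hd.not_indep)
      have key : ∀ y, y = partialBoundary k M.E (listMonomial k (n :: L.erase n)) →
          y ∈ (osRelations k (M ／ {n})).restrictScalars k ⊓
          ((osRelations k (M ／ {n})).restrictScalars k).comap (partialBoundary k {n}) := by
        rintro _ rfl
        rw [listMonomial_cons, partialBoundary_extGen_mul_of_mem hnE]
        refine ⟨sub_mem h1 ((osRelations k _).mul_mem_left _ h2), ?_⟩
        simp only [SetLike.mem_coe, Submodule.mem_comap, map_sub, h3,
          partialBoundary_extGen_mul_of_mem (Set.mem_singleton n), h4]
        simpa using h2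
      rcases partialBoundary_eq_or_neg_of_perm (k := k) M.E hp with h | h <;> rw [h]
      · exact key _ rfl
      · exact neg_mem (key _ rfl)
    · obtain ⟨-, h2, -, h4⟩ := hdep L hnL fun h => hd.not_indep (h.subset (Set.subset_insert _ _))
      refine ⟨h2, ?_⟩
      simp [h4]
  · rintro i x ⟨h1, h2⟩
    refine ⟨(osRelations k _).mul_mem_left _ h1, ?_⟩
    have h3 := (osRelations k (M ／ {n})).mul_mem_left (extGen k i) h2
    by_cases hi : i ∈ ({n} : Set α)
    · simp only [SetLike.mem_coe, Submodule.mem_comap, partialBoundary_extGen_mul_of_mem hi]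
      exact sub_mem h1 h3
    · simp only [SetLike.mem_coe, Submodule.mem_comap, partialBoundary_extGen_mul_of_notMem hi]
      exact neg_mem h3

/-- If L is dependent in M／n, then n together with L is dependent in M, and the relation ∂(e_n e_L)
= e_L - e_n ∂e_L trades e_n ∂e_L for e_L, which is free of e_n. -/
lemma exists_extGen_mul_sub_mem_osRelations {n : α} (hn : M.IsNonloop n)
    {x : ExteriorAlgebra k (α → k)} (hx : x ∈ osRelations k (M ／ {n})) :
    ∃ h, extRestrict k {n}ᶜ h = h ∧ extGen k n * x - h ∈ osRelations k M := by
  have hnE := hn.mem_ground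
  have hgr : (M ／ {n}).E = M.E \ {n} := rfl
  suffices x ∈ ((osRelations k M).restrictScalars k ⊔
      LinearMap.eqLocus (extRestrict k {n}ᶜ).toLinearMap LinearMap.id).comap
        (LinearMap.mulLeft k (extGen k n)) by
    obtain ⟨y, hy, h, hh, hyh⟩ := Submodule.mem_sup.mp this
    refine ⟨h, hh, ?_⟩
    rw [LinearMap.mulLeft_apply] at hyh
    rw [← hyh, add_sub_cancel_right]
    exact hy
  refine osRelations_le ?_ ?_ ?_ hx
  · intro i hi
    simp only [Submodule.mem_comap, LinearMap.mulLeft_apply]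
    refine Submodule.mem_sup_left ?_
    by_cases hin : i = n
    · subst hin; simp
    · exact (osRelations k M).mul_mem_left _ (extGen_mem_osRelations fun h => hi ⟨h, hin⟩)
  · intro L hL hd
    have hnL : n ∉ L := fun h => (hd.subset_ground h).2 rfl
    have hr : extRestrict k {n}ᶜ (listMonomial k L) = listMonomial k L :=
      extRestrict_listMonomial_of_subset fun i hi => by rintro rfl; exact hnL hi
    have h1 : ¬ M.Indep {i | i ∈ n :: L} := by
      intro h
      refine hd.not_indep (hn.contractElem_indep_iff.mpr ⟨hnL, ?_⟩)
      convert h using 1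
      ext; simp
    have h2 := partialBoundary_mem_osRelations (listMonomial_mem_osRelations (k := k) h1)
    rw [listMonomial_cons, partialBoundary_extGen_mul_of_mem hnE,
      partialBoundary_congr_of_extRestrict (T := M.E) (T' := (M ／ {n}).E) (X := {n}ᶜ)
        (by rw [hgr]; ext; simp) hr] at h2
    simp only [Submodule.mem_comap, LinearMap.mulLeft_apply]
    refine Submodule.mem_sup.mpr ⟨_, neg_mem h2, listMonomial k L, hr, by abel⟩
  · intro i x hx
    simp only [Submodule.mem_comap, LinearMap.mulLeft_apply] at hx ⊢
    obtain ⟨y, hy, h, hh, hyh⟩ := Submodule.mem_sup.mp hx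
    by_cases hin : i = n
    · subst hin; simp
    · rw [extGen_mul_swap, ← hyh, mul_add]
      refine neg_mem (Submodule.mem_sup.mpr ⟨_, (osRelations k M).mul_mem_left _ hy, _, ?_, rfl⟩)
      simp only [LinearMap.mem_eqLocus, AlgHom.toLinearMap_apply, LinearMap.id_apply,
        map_mul] at hh ⊢
      rw [hh, extRestrict_extGen_of_mem (by simpa using hin)]

/-- An element whose residue along `n` is a relation of the contraction comes from the
deletion. -/
theorem exists_sub_mem_osRelations_of_residue {n : α} (hn : M.IsNonloop n) {p : ℕ}
    {x : ExteriorAlgebra k (α → k)} (hp : x ∈ ⋀[k]^p (α → k))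
    (hx : partialBoundary k {n} x ∈ osRelations k (M ／ {n})) :
    ∃ h ∈ ⋀[k]^p (α → k), extRestrict k {n}ᶜ h = h ∧ x - h ∈ osRelations k M := by
  obtain ⟨h, hh, hxh⟩ := exists_extGen_mul_sub_mem_osRelations hn hx
  -- Write x as its part free of e_n plus e_n times its residue, and replace the latter by h. Since
  -- h need not be homogeneous, the degree p component is taken.
  refine ⟨extComponent k α p (extRestrict k {n}ᶜ x + h), extComponent_mem _ _, ?_, ?_⟩
  · rw [extRestrict_extComponent, map_add, hh, extRestrict_extRestrict, Set.inter_self]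
  · have : x - (extRestrict k {n}ᶜ x + h) ∈ osRelations k M := by
      rw [extRestrict_compl_sub]
      convert hxh using 1
      abel
    have := extComponent_mem_osRelations p this
    rwa [map_sub, extComponent_of_mem hp] at this

end OrlikSolomonRelations

/-! ### Exactness of the generic complex by deletion and contraction. -/

noncomputable section GenericComplex

set_option linter.unusedSectionVars false

variable {k : Type*} [Field k] {α : Type*} [Fintype α] [DecidableEq α] {M : Matroid α}

/-- The ideal is a left ideal by definition; its homogeneous generators commute with e_j up to sign,
so it is two-sided. -/
lemma mul_extGen_mem_osRelations (j : α) {x : ExteriorAlgebra k (α → k)}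
    (hx : x ∈ osRelations k M) : x * extGen k j ∈ osRelations k M := by
  have hom : ∀ {q : ℕ} {x : ExteriorAlgebra k (α → k)}, x ∈ ⋀[k]^q (α → k) →
      x ∈ osRelations k M → x * extGen k j ∈ osRelations k M := by
    intro q x hq hx
    rw [extGen, mul_ι_of_mem_extPow _ hq]
    exact smul_mem_osRelations _ ((osRelations k M).mul_mem_left _ hx)
  suffices x ∈ ((osRelations k M).restrictScalars k).comap
    (LinearMap.mulRight k (extGen k j)) from this
  refine osRelations_le (fun i hi => hom (extGen_mem_extPow i) (extGen_mem_osRelations hi))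
    (fun L hL hd => hom (partialBoundary_mem_extPow _ (listMonomial_mem_extPow L) ?_)
      (partialBoundary_listMonomial_mem_osRelations hL hd)) ?_ hx
  · cases L with
    | nil => exact absurd hd.not_indep (by simp)
    | cons => simp
  · intro i x hx
    simp only [Submodule.mem_comap, LinearMap.mulRight_apply, mul_assoc] at hx ⊢
    exact (osRelations k M).mul_mem_left _ hx

lemma mul_right_mem_osRelations (y : ExteriorAlgebra k (α → k)) :
    ∀ {x : ExteriorAlgebra k (α → k)}, x ∈ osRelations k M → x * y ∈ osRelations k M := by
  induction y using ExteriorAlgebra.induction with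
  | algebraMap r =>
    intro x hx
    rw [← Algebra.commutes]
    exact (osRelations k M).mul_mem_left _ hx
  | ι v =>
    intro x hx
    rw [ι_eq_sum_extGen, Finset.mul_sum]
    refine sum_mem fun i _ => ?_
    rw [mul_smul_comm]
    exact smul_mem_osRelations _ (mul_extGen_mem_osRelations i hx)
  | mul a b ha hb => intro x hx; rw [← mul_assoc]; exact hb (ha hx)
  | add a b ha hb => intro x hx; rw [mul_add]; exact add_mem (ha hx) (hb hx)

/-! ### The generic complex

Families of elements of the exterior algebra indexed by exponents `m : α →₀ ℕ` are
regarded as power series in variables `x_i`, `i : α`, with coefficients in the exterior algebra. -/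

/-- Multiplication of a power series by `x_i e_i`. -/
def varMul (k : Type*) [Field k] {α : Type*} [DecidableEq α] (i : α) :
    Module.End k ((α →₀ ℕ) → ExteriorAlgebra k (α → k)) where
  toFun f m := if m i = 0 then 0 else extGen k i * f (m - Finsupp.single i 1)
  map_add' f g := by ext m; by_cases h : m i = 0 <;> simp [h, mul_add]
  map_smul' c f := by ext m; by_cases h : m i = 0 <;> simp [h]

/-- Multiplication of a power series by `∑ i ∈ T, x_i e_i`. -/
def genericMul (k : Type*) [Field k] {α : Type*} [Fintype α] [DecidableEq α] (T : Set α) :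
    Module.End k ((α →₀ ℕ) → ExteriorAlgebra k (α → k)) :=
  ∑ i ∈ (Set.toFinite T).toFinset, varMul k i

lemma varMul_apply (i : α) (f : (α →₀ ℕ) → ExteriorAlgebra k (α → k)) (m : α →₀ ℕ) :
    varMul k i f m = if m i = 0 then 0 else extGen k i * f (m - Finsupp.single i 1) := rfl

lemma genericMul_apply (T : Set α) (f : (α →₀ ℕ) → ExteriorAlgebra k (α → k)) (m : α →₀ ℕ) :
    genericMul k T f m = ∑ i ∈ (Set.toFinite T).toFinset, varMul k i f m := by
  simp [genericMul]

lemma varMul_mul_varMul (i j : α) : varMul k i * varMul k j = -(varMul k j * varMul k i) := by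
  ext f m
  simp only [Module.End.mul_apply, varMul_apply, LinearMap.neg_apply, Pi.neg_apply]
  by_cases hij : i = j
  · subst hij; simp
  · have h1 : (m - Finsupp.single i 1 : α →₀ ℕ) j = m j := by simp [hij]
    have h2 : (m - Finsupp.single j 1 : α →₀ ℕ) i = m i := by simp [Ne.symm hij]
    rw [h1, h2, tsub_right_comm]
    by_cases hi : m i = 0 <;> by_cases hj : m j = 0 <;> simp [hi, hj]
    rw [extGen_mul_swap]

lemma varMul_mul_self (i : α) : varMul k i * varMul k i = 0 := by
  ext f m
  simp only [Module.End.mul_apply, varMul_apply]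
  by_cases hi : m i = 0 <;> simp [hi]

lemma genericMul_genericMul (T : Set α) (f : (α →₀ ℕ) → ExteriorAlgebra k (α → k)) :
    genericMul k T (genericMul k T f) = 0 := by
  suffices ∀ S : Finset α, (∑ i ∈ S, varMul k i) * (∑ i ∈ S, varMul k i) = 0 by
    exact LinearMap.congr_fun (this _) f
  intro S
  induction S using Finset.induction_on with
  | empty => simp
  | insert i S hi ih =>
    rw [Finset.sum_insert hi, add_mul, mul_add, mul_add, ih, varMul_mul_self, Finset.mul_sum,
      Finset.sum_mul, Finset.sum_congr rfl fun j _ => varMul_mul_varMul i j]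
    simp

lemma genericMul_eq_add {T : Set α} {n : α} (hn : n ∈ T) :
    genericMul k T = genericMul k (T \ {n}) + varMul k n := by
  rw [genericMul, genericMul, ← Finset.sum_erase_add _ _
    (show n ∈ (Set.toFinite T).toFinset by simpa using hn)]
  congr 2
  ext; simp [and_comm]

lemma genericMul_mem {T : Set α} {J : Ideal (ExteriorAlgebra k (α → k))}
    {f : (α →₀ ℕ) → ExteriorAlgebra k (α → k)} (hf : ∀ m, f m ∈ J) (m : α →₀ ℕ) :
    genericMul k T f m ∈ J := by
  rw [genericMul_apply]
  refine sum_mem fun i _ => ?_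
  rw [varMul_apply]
  split_ifs
  · exact zero_mem _
  · exact J.mul_mem_left _ (hf _)

/-- The degree `j - 1` part of the exterior algebra, zero for `j = 0`. -/
def extPowPred (k : Type*) [Field k] (α : Type*) : ℕ → Submodule k (ExteriorAlgebra k (α → k))
  | 0 => ⊥
  | j + 1 => ⋀[k]^j (α → k)

lemma extGen_mul_mem_extPowPred (i : α) {j : ℕ} {x : ExteriorAlgebra k (α → k)}
    (hx : x ∈ extPowPred k α j) : extGen k i * x ∈ ⋀[k]^j (α → k) := by
  cases j with
  | zero =>
    rw [extPowPred, Submodule.mem_bot] at hx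
    rw [hx, mul_zero]; exact zero_mem _
  | succ j => exact extGen_mul_mem_extPow i hx

lemma extRestrict_mem_extPowPred (X : Set α) {j : ℕ} {x : ExteriorAlgebra k (α → k)}
    (hx : x ∈ extPowPred k α j) : extRestrict k X x ∈ extPowPred k α j := by
  cases j with
  | zero =>
    rw [extPowPred, Submodule.mem_bot] at hx ⊢
    rw [hx, map_zero]
  | succ j => exact extRestrict_mem_extPow X hx

lemma partialBoundary_mem_extPowPred (T : Set α) {j : ℕ} {x : ExteriorAlgebra k (α → k)}
    (hx : x ∈ ⋀[k]^j (α → k)) : partialBoundary k T x ∈ extPowPred k α j := by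
  cases j with
  | zero =>
    rw [extPowPred, Submodule.mem_bot]
    exact partialBoundary_eq_zero_of_mem_extPow_zero T hx
  | succ j => exact partialBoundary_mem_extPow T hx (by omega)

lemma genericMul_mem_extPow {T : Set α} {j : ℕ} {f : (α →₀ ℕ) → ExteriorAlgebra k (α → k)}
    (hf : ∀ m, f m ∈ extPowPred k α j) (m : α →₀ ℕ) :
    genericMul k T f m ∈ ⋀[k]^j (α → k) := by
  rw [genericMul_apply]
  refine sum_mem fun i _ => ?_
  rw [varMul_apply]
  split_ifs
  · exact zero_mem _
  · exact extGen_mul_mem_extPowPred i (hf _)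

lemma genericMul_map {T : Set α} (c : k)
    (φ : ExteriorAlgebra k (α → k) →ₗ[k] ExteriorAlgebra k (α → k))
    (hφ : ∀ i ∈ T, ∀ x, φ (extGen k i * x) = c • (extGen k i * φ x))
    (f : (α →₀ ℕ) → ExteriorAlgebra k (α → k)) (m : α →₀ ℕ) :
    φ (genericMul k T f m) = c • genericMul k T (fun m => φ (f m)) m := by
  simp only [genericMul_apply, map_sum, Finset.smul_sum]
  refine Finset.sum_congr rfl fun i hi => ?_
  rw [varMul_apply, varMul_apply]
  split_ifs
  · simp
  · exact hφ i (by simpa using hi) _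

lemma genericMul_extGen_mul {T : Set α} (n : α) (f : (α →₀ ℕ) → ExteriorAlgebra k (α → k))
    (m : α →₀ ℕ) :
    genericMul k T (fun m => extGen k n * f m) m = -(extGen k n * genericMul k T f m) := by
  have := genericMul_map (T := T) (-1) (LinearMap.mulLeft k (extGen k n))
    (fun i _ x => by simp [extGen_mul_swap n i]) f m
  simp only [LinearMap.mulLeft_apply, neg_smul, one_smul] at this
  rw [this, neg_neg]

lemma extRestrict_genericMul {T X : Set α} (h : T ⊆ X)
    (f : (α →₀ ℕ) → ExteriorAlgebra k (α → k)) (m : α →₀ ℕ) :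
    extRestrict k X (genericMul k T f m) = genericMul k T (fun m => extRestrict k X (f m)) m := by
  have := genericMul_map (T := T) 1 (extRestrict k X).toLinearMap
    (fun i hi x => by simp [extRestrict_extGen_of_mem (h hi)]) f m
  simpa using this

lemma partialBoundary_genericMul {T S : Set α} (h : Disjoint T S)
    (f : (α →₀ ℕ) → ExteriorAlgebra k (α → k)) (m : α →₀ ℕ) :
    partialBoundary k S (genericMul k T f m)
      = -genericMul k T (fun m => partialBoundary k S (f m)) m := by
  have := genericMul_map (T := T) (-1) (partialBoundary k S)
    (fun i hi x => by
      simp [partialBoundary_extGen_mul_of_notMem (Set.disjoint_left.mp h hi)]) f m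
  simpa using this

/-- Without the variable `x_n`, multiplication does not change the exponent of `x_n`. -/
lemma genericMul_update {T : Set α} {n : α} (hn : n ∉ T)
    (f g : (α →₀ ℕ) → ExteriorAlgebra k (α → k)) (m : α →₀ ℕ) (r : ℕ)
    (h : ∀ m' : α →₀ ℕ, m' n = m n → f (m'.update n r) = g m') :
    genericMul k T f (m.update n r) = genericMul k T g m := by
  simp only [genericMul_apply]
  refine Finset.sum_congr rfl fun i hi => ?_
  have hin : i ≠ n := by rintro rfl; exact hn (by simpa using hi)
  have h1 : (m.update n r) i = m i := by simp [Finsupp.update, hin]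
  have h2 : m.update n r - Finsupp.single i 1 = (m - Finsupp.single i 1).update n r := by
    ext j
    by_cases hj : j = n
    · subst hj; simp [hin]
    · simp [hj]
  rw [varMul_apply, varMul_apply, h1, h2, h]
  simp [hin]

/-- Exactness of the generic complex of `M` below the rank. -/
def GenericExact (k : Type*) [Field k] {α : Type*} [Fintype α] [DecidableEq α]
    (M : Matroid α) : Prop :=
  ∀ q : ℕ, ((q + 1 : ℕ) : ℕ∞) ≤ M.eRank → ∀ f : (α →₀ ℕ) → ExteriorAlgebra k (α → k),
    (∀ m, f m ∈ ⋀[k]^q (α → k)) → (∀ m, genericMul k M.E f m ∈ osRelations k M) →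
    ∃ g : (α →₀ ℕ) → ExteriorAlgebra k (α → k), (∀ m, g m ∈ extPowPred k α q) ∧
      ∀ m, f m - genericMul k M.E g m ∈ osRelations k M

/-- Write d for multiplication by ∑_{i≠n} x_i e_i. It acts on the deletion–contraction sequence,
anticommuting with the residue, so exactness for the deletion in degree q and for the contraction in
degree q - 1 gives exactness on A(M) in degree q. -/
lemma exists_genericMul_omit {n : α} (hn : M.IsNonloop n)
    (hdel : GenericExact k (M ＼ {n})) (hcon : GenericExact k (M ／ {n})) {q : ℕ}
    (hq : ((q + 1 : ℕ) : ℕ∞) ≤ (M ＼ {n}).eRank) (hq' : (q : ℕ∞) ≤ (M ／ {n}).eRank)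
    {f : (α →₀ ℕ) → ExteriorAlgebra k (α → k)} (hf : ∀ m, f m ∈ ⋀[k]^q (α → k))
    (hfM : ∀ m, genericMul k (M.E \ {n}) f m ∈ osRelations k M) :
    ∃ g : (α →₀ ℕ) → ExteriorAlgebra k (α → k), (∀ m, g m ∈ extPowPred k α q) ∧
      ∀ m, f m - genericMul k (M.E \ {n}) g m ∈ osRelations k M := by
  have hT : Disjoint (M.E \ {n}) {n} := Set.disjoint_sdiff_left
  have hTn : M.E \ {n} ⊆ {n}ᶜ := fun i hi => hi.2
  have hen : extGen k n ∈ osRelations k (M ／ {n}) :=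
    extGen_mem_osRelations fun h => h.2 rfl
  -- A primitive u of the residue of f in the contraction. Its degree is stated through e_n u, so
  -- that q = 0 and q = 1 fit without degrees -2 and -1.
  obtain ⟨u, hu1, hu2, hu3⟩ : ∃ u : (α →₀ ℕ) → ExteriorAlgebra k (α → k),
      (∀ m, extGen k n * u m ∈ extPowPred k α q) ∧ (∀ m, extRestrict k {n}ᶜ (u m) = u m) ∧
      ∀ m, partialBoundary k {n} (f m) - genericMul k (M.E \ {n}) u m
        ∈ osRelations k (M ／ {n}) := by
    cases q with
    | zero =>
      refine ⟨0, fun m => by simp, fun m => by simp, fun m => ?_⟩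
      rw [partialBoundary_eq_zero_of_mem_extPow_zero _ (hf m), map_zero]
      simp
    | succ q =>
      obtain ⟨u, hu, hu'⟩ := hcon q hq' (fun m => partialBoundary k {n} (f m))
        (fun m => partialBoundary_mem_extPow _ (hf m) (by omega)) (fun m => by
          rw [← neg_mem_iff]
          change -genericMul k (M.E \ {n}) _ m ∈ _
          rw [← partialBoundary_genericMul hT]
          exact (mem_osRelations_contract hn (hfM m)).2)
      -- Dropping the multiples of e_n from u is harmless: e_n is a relation of the contraction.
      refine ⟨fun m => extRestrict k {n}ᶜ (u m),
        fun m => extGen_mul_mem_extPowPred n (extRestrict_mem_extPowPred _ (hu m)),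
        fun m => by rw [extRestrict_extRestrict, Set.inter_self], fun m => ?_⟩
      have h1 : ∀ m, (u - fun m => extRestrict k {n}ᶜ (u m)) m ∈ osRelations k (M ／ {n}) := by
        intro m
        rw [Pi.sub_apply, extRestrict_compl_sub, sub_sub_cancel]
        exact mul_right_mem_osRelations _ hen
      have h2 := genericMul_mem (T := M.E \ {n}) h1 m
      rw [map_sub, Pi.sub_apply] at h2
      convert add_mem (hu' m) h2 using 1
      change _ = partialBoundary k {n} (f m) - genericMul k (M.E \ {n}) u m + _
      abel
  let v : (α →₀ ℕ) → ExteriorAlgebra k (α → k) := fun m => extGen k n * u m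
  -- The residue of d(e_n u) is -du, so adding dv with v = e_n u cancels the residue of f modulo
  -- relations. The sum then comes from a cocycle h of the deletion.
  have hρ : ∀ m, partialBoundary k {n} (f m + genericMul k (M.E \ {n}) v m)
      ∈ osRelations k (M ／ {n}) := by
    intro m
    have h1 : (fun m => partialBoundary k {n} (v m)) = u := by
      ext m
      simp only [v]
      rw [partialBoundary_extGen_mul_of_mem (Set.mem_singleton n),
        partialBoundary_singleton_eq_zero (hu2 m), mul_zero, sub_zero]
    rw [map_add, partialBoundary_genericMul hT, h1, ← sub_eq_add_neg]
    exact hu3 m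
  have hdeg : ∀ m, f m + genericMul k (M.E \ {n}) v m ∈ ⋀[k]^q (α → k) := fun m =>
    add_mem (hf m) (genericMul_mem_extPow hu1 m)
  choose h hh1 hh2 hh3 using fun m => exists_sub_mem_osRelations_of_residue hn (hdeg m) (hρ m)
  have hdh : ∀ m, genericMul k (M.E \ {n}) h m ∈ osRelations k (M ＼ {n}) := by
    intro m
    refine mem_osRelations_delete (p := q + 1) hn (genericMul_mem_extPow hh1 m) ?_ ?_
    · rw [extRestrict_genericMul hTn]; simp only [hh2]
    · have h1 := genericMul_mem (T := M.E \ {n})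
        (f := f + genericMul k (M.E \ {n}) v - h) hh3 m
      rw [map_sub, map_add, genericMul_genericMul, add_zero, Pi.sub_apply] at h1
      simpa using sub_mem (hfM m) h1
  obtain ⟨w, hw1, hw2⟩ := hdel q hq h hh1 hdh
  refine ⟨(fun m => extRestrict k {n}ᶜ (w m)) - v,
    fun m => sub_mem (extRestrict_mem_extPowPred _ (hw1 m)) (hu1 m), fun m => ?_⟩
  have h1 := extRestrict_mem_of_mem_osRelations_delete (hw2 m)
  change extRestrict k {n}ᶜ (h m - genericMul k (M.E \ {n}) w m) ∈ _ at h1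
  rw [map_sub, hh2, extRestrict_genericMul hTn] at h1
  convert add_mem h1 (hh3 m) using 1
  rw [map_sub, Pi.sub_apply]
  abel

/-- Let d omit the term x_n e_n. Writing f = ∑ f_r x_n^r, the equation to solve is d g_r = f_r - e_n
g_{r-1} for each r. Its right side h_r is a d-cocycle modulo relations, since d h_r ≡ d f_r + e_n
h_{r-1} = d f_r + e_n f_{r-1}. -/
lemma exists_genericMul_of_omit {n : α} (hn : n ∈ M.E) {q : ℕ}
    (H : ∀ f : (α →₀ ℕ) → ExteriorAlgebra k (α → k), (∀ m, f m ∈ ⋀[k]^q (α → k)) →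
      (∀ m, genericMul k (M.E \ {n}) f m ∈ osRelations k M) →
      ∃ g : (α →₀ ℕ) → ExteriorAlgebra k (α → k), (∀ m, g m ∈ extPowPred k α q) ∧
        ∀ m, f m - genericMul k (M.E \ {n}) g m ∈ osRelations k M)
    {f : (α →₀ ℕ) → ExteriorAlgebra k (α → k)} (hf : ∀ m, f m ∈ ⋀[k]^q (α → k))
    (hfM : ∀ m, genericMul k M.E f m ∈ osRelations k M) :
    ∃ g : (α →₀ ℕ) → ExteriorAlgebra k (α → k), (∀ m, g m ∈ extPowPred k α q) ∧
      ∀ m, f m - genericMul k M.E g m ∈ osRelations k M := by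
  have hnT : n ∉ M.E \ {n} := fun h => h.2 rfl
  -- The choice of primitive is made total, so that the recursion for `G` needs no proofs; `good`
  -- later shows that it is only applied to cocycles.
  have H' : ∀ f : (α →₀ ℕ) → ExteriorAlgebra k (α → k),
      ∃ g : (α →₀ ℕ) → ExteriorAlgebra k (α → k), (∀ m, f m ∈ ⋀[k]^q (α → k)) →
      (∀ m, genericMul k (M.E \ {n}) f m ∈ osRelations k M) →
      (∀ m, g m ∈ extPowPred k α q) ∧
        ∀ m, f m - genericMul k (M.E \ {n}) g m ∈ osRelations k M := by
    intro f
    by_cases h1 : ∀ m, f m ∈ ⋀[k]^q (α → k)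
    · by_cases h2 : ∀ m, genericMul k (M.E \ {n}) f m ∈ osRelations k M
      · obtain ⟨g, hg⟩ := H f h1 h2
        exact ⟨g, fun _ _ => hg⟩
      · exact ⟨0, fun _ h => absurd h h2⟩
    · exact ⟨0, fun h => absurd h h1⟩
  choose s hs using H'
  -- The coefficient of x_n^r, extended independently of the exponent of x_n, since d ignores that
  -- exponent.
  let slice : ℕ → (α →₀ ℕ) → ExteriorAlgebra k (α → k) := fun r m => f (m.update n r)
  let G : ℕ → (α →₀ ℕ) → ExteriorAlgebra k (α → k) := fun r =>
    Nat.rec (s (slice 0)) (fun r Gr => s (slice (r + 1) - fun m => extGen k n * Gr m)) r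
  let h : ℕ → (α →₀ ℕ) → ExteriorAlgebra k (α → k) := fun r =>
    match r with
    | 0 => slice 0
    | r + 1 => slice (r + 1) - fun m => extGen k n * G r m
  have hG : ∀ r, G r = s (h r) := by
    intro r; cases r <;> rfl
  have hen : ∀ r m, extGen k n * h r m = extGen k n * f (m.update n r) := by
    intro r m
    cases r with
    | zero => rfl
    | succ r => simp [h, slice, mul_sub]
  have hslice : ∀ r m, genericMul k (M.E \ {n}) (slice r) m
      = genericMul k (M.E \ {n}) f (m.update n r) := fun r m =>
    (genericMul_update hnT f (slice r) m r fun _ _ => rfl).symm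
  have good : ∀ r, (∀ m, h r m ∈ ⋀[k]^q (α → k)) ∧
      (∀ m, genericMul k (M.E \ {n}) (h r) m ∈ osRelations k M) := by
    intro r
    induction r with
    | zero =>
      refine ⟨fun m => hf _, fun m => ?_⟩
      have h1 := hfM (m.update n 0)
      rw [genericMul_eq_add hn, LinearMap.add_apply, Pi.add_apply, varMul_apply,
        if_pos (by simp), add_zero] at h1
      change genericMul k (M.E \ {n}) (slice 0) m ∈ _
      rwa [hslice]
    | succ r ih =>
      have hGr := hs (h r) ih.1 ih.2
      rw [← hG] at hGr
      refine ⟨fun m => sub_mem (hf _) (extGen_mul_mem_extPowPred n (hGr.1 m)), fun m => ?_⟩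
      have h1 := hfM (m.update n (r + 1))
      rw [genericMul_eq_add hn, LinearMap.add_apply, Pi.add_apply, varMul_apply,
        if_neg (by simp)] at h1
      have h2 : m.update n (r + 1) - Finsupp.single n 1 = m.update n r := by
        ext j
        by_cases hj : j = n
        · subst hj; simp
        · simp [hj]
      rw [h2, ← hen] at h1
      have h3 := (osRelations k M).mul_mem_left (extGen k n) (hGr.2 m)
      change genericMul k (M.E \ {n}) (slice (r + 1) - fun m => extGen k n * G r m) m ∈ _
      rw [map_sub, Pi.sub_apply, genericMul_extGen_mul, hslice]
      convert sub_mem h1 h3 using 1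
      rw [mul_sub]
      abel
  have hGr : ∀ r, (∀ m, G r m ∈ extPowPred k α q) ∧
      ∀ m, h r m - genericMul k (M.E \ {n}) (G r) m ∈ osRelations k M := fun r => by
    rw [hG]; exact hs (h r) (good r).1 (good r).2
  -- The slices `G r` are assembled by reading each at exponent 0 of x_n.
  refine ⟨fun m => G (m n) (m.update n 0), fun m => (hGr _).1 _, fun m => ?_⟩
  have hm : (m.update n 0).update n (m n) = m := by simp
  have h1 : genericMul k (M.E \ {n}) (fun m => G (m n) (m.update n 0)) m
      = genericMul k (M.E \ {n}) (G (m n)) (m.update n 0) := by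
    refine (genericMul_update hnT _ _ m 0 fun m' hm' => ?_).symm
    rw [hm']
  rw [genericMul_eq_add hn, LinearMap.add_apply, Pi.add_apply, h1]
  convert (hGr (m n)).2 (m.update n 0) using 1
  rw [varMul_apply]
  cases hr : m n with
  | zero =>
    rw [hr] at hm
    simp [h, slice, hm]
  | succ r =>
    rw [hr] at hm
    have h2 : (m - Finsupp.single n 1).update n 0 = m.update n 0 := by
      ext j
      by_cases hj : j = n
      · subst hj; simp
      · simp [hj]
    have h3 : (m - Finsupp.single n 1 : α →₀ ℕ) n = r := by simp [hr]
    rw [if_neg (Nat.succ_ne_zero r), h2, h3]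
    simp only [h, slice, Pi.sub_apply, hm]
    abel

/-- Write f = a + e_n b with a and b free of e_n, and let d omit x_n e_n. The residue of the cocycle
condition says db ≡ x_n a. So b₀, the part of b without x_n, is a d-cocycle, say b₀ ≡ dc, and (b -
b₀)/x_n - e_n c is a primitive of f. -/
lemma exists_genericMul_of_isColoop {n : α} (hn : M.IsNonloop n)
    (hco : M ／ {n} = M ＼ {n}) (hdel : GenericExact k (M ＼ {n})) {q : ℕ}
    (hq : (q : ℕ∞) ≤ (M ＼ {n}).eRank)
    {f : (α →₀ ℕ) → ExteriorAlgebra k (α → k)} (hf : ∀ m, f m ∈ ⋀[k]^q (α → k))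
    (hfM : ∀ m, genericMul k M.E f m ∈ osRelations k M) :
    ∃ g : (α →₀ ℕ) → ExteriorAlgebra k (α → k), (∀ m, g m ∈ extPowPred k α q) ∧
      ∀ m, f m - genericMul k M.E g m ∈ osRelations k M := by
  have hnE := hn.mem_ground
  have hT : Disjoint (M.E \ {n}) {n} := Set.disjoint_sdiff_left
  have hTn : M.E \ {n} ⊆ {n}ᶜ := fun i hi => hi.2
  have hnT : n ∉ M.E \ {n} := fun h => h.2 rfl
  let a : (α →₀ ℕ) → ExteriorAlgebra k (α → k) := fun m => extRestrict k {n}ᶜ (f m)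
  let b : (α →₀ ℕ) → ExteriorAlgebra k (α → k) := fun m => partialBoundary k {n} (f m)
  have hb : ∀ m, extRestrict k {n}ᶜ (b m) = b m := fun m =>
    extRestrict_compl_partialBoundary n (f m)
  have hfab : ∀ m, f m = a m + extGen k n * b m := fun m => by
    simp only [a, b]; rw [extRestrict_compl_sub]; abel
  have key' : ∀ m, genericMul k (M.E \ {n}) b m
      - (if m n = 0 then 0 else a (m - Finsupp.single n 1)) ∈ osRelations k (M ＼ {n}) := by
    intro m
    have h1 := (mem_osRelations_contract hn (hfM m)).2
    rw [hco, genericMul_eq_add hnE, LinearMap.add_apply, Pi.add_apply, map_add,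
      partialBoundary_genericMul hT, varMul_apply, ← neg_mem_iff] at h1
    convert h1 using 1
    rw [neg_add, neg_neg, sub_eq_add_neg]
    congr 2
    split_ifs
    · simp
    · rw [partialBoundary_extGen_mul_of_mem (Set.mem_singleton n), ← extRestrict_compl_sub]
  have key : ∀ m, genericMul k (M.E \ {n}) b m
      - (if m n = 0 then 0 else a (m - Finsupp.single n 1)) ∈ osRelations k M := by
    intro m
    have h1 := extRestrict_mem_of_mem_osRelations_delete (key' m)
    rw [map_sub, extRestrict_genericMul hTn] at h1
    simp only [hb] at h1
    convert h1 using 2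
    split_ifs
    · simp
    · simp only [a]; rw [extRestrict_extRestrict, Set.inter_self]
  obtain ⟨c, hc1, hc2⟩ : ∃ c : (α →₀ ℕ) → ExteriorAlgebra k (α → k),
      (∀ m, extGen k n * c m ∈ extPowPred k α q) ∧
      ∀ m : α →₀ ℕ, m n = 0 → b m - genericMul k (M.E \ {n}) c m ∈ osRelations k M := by
    cases q with
    | zero =>
      refine ⟨0, fun m => by simp, fun m _ => ?_⟩
      simp only [b]
      rw [partialBoundary_eq_zero_of_mem_extPow_zero _ (hf m), map_zero]
      simp
    | succ q =>
      obtain ⟨c, hc, hc'⟩ := hdel q hq (fun m => b (m.update n 0))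
        (fun m => partialBoundary_mem_extPow _ (hf _) (by omega)) (fun m => by
          change genericMul k (M.E \ {n}) _ m ∈ _
          rw [← genericMul_update hnT b (fun m => b (m.update n 0)) m 0 fun _ _ => rfl]
          have := key' (m.update n 0)
          rwa [if_pos (by simp), sub_zero] at this)
      refine ⟨fun m => extRestrict k {n}ᶜ (c m),
        fun m => extGen_mul_mem_extPowPred n (extRestrict_mem_extPowPred _ (hc m)),
        fun m hm => ?_⟩
      have h1 := extRestrict_mem_of_mem_osRelations_delete (hc' m)
      have hm' : m.update n 0 = m := by
        ext j
        by_cases hj : j = n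
        · subst hj; simp [hm]
        · simp [hj]
      change extRestrict k {n}ᶜ (b (m.update n 0) - genericMul k (M.E \ {n}) c m) ∈ _ at h1
      rwa [map_sub, hb, extRestrict_genericMul hTn, hm'] at h1
  -- `g₁` is (b - b₀)/x_n, and `g₂` is e_n c placed on exponent 0 of x_n. Then d g₁ ≡ a, x_n e_n g₁
  -- = e_n (b - b₀), -d g₂ ≡ e_n b₀ and x_n e_n g₂ = 0.
  let g₁ : (α →₀ ℕ) → ExteriorAlgebra k (α → k) := fun m => b (m + Finsupp.single n 1)
  let g₂ : (α →₀ ℕ) → ExteriorAlgebra k (α → k) := fun m =>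
    if m n = 0 then extGen k n * c m else 0
  refine ⟨g₁ - g₂, fun m => sub_mem (partialBoundary_mem_extPowPred _ (hf _)) ?_, fun m => ?_⟩
  · simp only [g₂]
    split_ifs
    · exact hc1 m
    · exact zero_mem _
  have e1 : genericMul k (M.E \ {n}) g₁ m
      = genericMul k (M.E \ {n}) b (m + Finsupp.single n 1) := by
    have hm : m + Finsupp.single n 1 = m.update n (m n + 1) := by
      ext j
      by_cases hj : j = n
      · subst hj; simp
      · simp [hj]
    rw [hm]
    refine (genericMul_update hnT b g₁ m _ fun m' hm' => ?_).symm
    simp only [g₁]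
    congr 1
    ext j
    by_cases hj : j = n
    · subst hj; simp [hm']
    · simp [hj]
  have e2 : genericMul k (M.E \ {n}) g₂ m
      = if m n = 0 then -(extGen k n * genericMul k (M.E \ {n}) c m) else 0 := by
    have hm : m.update n (m n) = m := by simp
    split_ifs with h0
    · rw [← genericMul_extGen_mul]
      conv_lhs => rw [← hm]
      refine genericMul_update hnT _ _ m _ fun m' hm' => ?_
      rw [← hm', Finsupp.update_self]
      simp [g₂, hm', h0]
    · conv_lhs => rw [← hm]
      rw [genericMul_update hnT g₂ 0 m _ fun m' hm' => ?_]
      · simp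
      · rw [← hm', Finsupp.update_self]
        simp [g₂, hm', h0]
  have e3 : varMul k n (g₁ - g₂) m = if m n = 0 then 0 else extGen k n * b m := by
    rw [varMul_apply]
    split_ifs with h0
    · rfl
    · have hm : m - Finsupp.single n 1 + Finsupp.single n 1 = m := by
        ext j
        by_cases hj : j = n
        · subst hj; simp; omega
        · simp [hj]
      simp only [Pi.sub_apply, g₁, g₂, hm, mul_sub]
      split_ifs <;> simp
  have k1 := key (m + Finsupp.single n 1)
  rw [if_neg (by simp), add_tsub_cancel_right] at k1
  rw [genericMul_eq_add hnE, LinearMap.add_apply, Pi.add_apply, e3, map_sub, Pi.sub_apply, e1, e2,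
    hfab m]
  by_cases h0 : m n = 0
  · have h2 := (osRelations k M).mul_mem_left (extGen k n) (hc2 m h0)
    convert sub_mem h2 k1 using 1
    simp only [h0, if_true, mul_sub]
    abel
  · convert neg_mem k1 using 1
    simp only [h0, if_false]
    abel

/-- The generic complex of the Orlik-Solomon algebra is exact below the rank. -/
theorem genericExact (M : Matroid α) : GenericExact k M := by
  induction hN : M.E.ncard using Nat.strong_induction_on generalizing M with
  | _ N ih =>
  intro q hq f hf hfM
  by_cases hloop : ∃ i, M.IsLoop i
  · obtain ⟨i, hi⟩ := hloop
    refine ⟨0, fun m => by simp, fun m => ?_⟩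
    rw [(Ideal.eq_top_iff_one _).mpr (one_mem_osRelations_of_isLoop hi)]
    trivial
  · push Not at hloop
    obtain ⟨n, hnE⟩ : M.E.Nonempty := by
      rw [Set.nonempty_iff_ne_empty]
      intro h
      have := hq.trans M.eRank_le_encard_ground
      rw [h, Set.encard_empty] at this
      exact absurd this (by simp)
    have hn : M.IsNonloop n := (Matroid.not_isLoop_iff hnE).mp (hloop n)
    have hlt : (M.E \ {n}).ncard < N := hN ▸ Set.ncard_sdiff_singleton_lt_of_mem hnE
    have hdel := ih _ hlt (M ＼ {n}) rfl
    have hcon := ih _ hlt (M ／ {n}) rfl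
    -- Contracting a nonloop lowers the rank by one, matching the degree shift of the residue;
    -- deleting a non-coloop preserves it.
    have hq' : (q : ℕ∞) ≤ (M ／ {n}).eRank := by
      obtain ⟨B, hB, hnB⟩ := hn.exists_mem_isBase
      have h1 : (M ／ {n}).Indep (B \ {n}) := by
        rw [hn.contractElem_indep_iff, Set.insert_sdiff_self_of_mem hnB]
        exact ⟨fun h => h.2 rfl, hB.indep⟩
      rw [← hB.encard_eq_eRank, ← Set.encard_sdiff_singleton_add_one hnB, Nat.cast_add,
        Nat.cast_one] at hq
      exact ((ENat.add_le_add_iff_right (by simp)).mp hq).trans h1.encard_le_eRank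
    by_cases hco : M.IsColoop n
    · have hcd : M ／ {n} = M ＼ {n} :=
        Matroid.contract_eq_delete_of_subset_coloops (by simpa [Matroid.isColoop_iff_mem_coloops] using hco)
      exact exists_genericMul_of_isColoop hn hcd hdel (hcd ▸ hq') hf hfM
    · have hq'' : ((q + 1 : ℕ) : ℕ∞) ≤ (M ＼ {n}).eRank := by
        rw [Matroid.isColoop_iff_forall_mem_isBase] at hco
        push Not at hco
        obtain ⟨B, hB, hnB⟩ := hco
        have h1 : (M ＼ {n}).Indep B := Matroid.deleteElem_indep_iff.mpr ⟨hB.indep, hnB⟩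
        rw [← hB.encard_eq_eRank] at hq
        exact hq.trans h1.encard_le_eRank
      exact exists_genericMul_of_omit hnE
        (fun f hf hfM => exists_genericMul_omit hn hdel hcon hq'' hq' hf hfM) hf hfM

end GenericComplex

/-! ### Lifting a cocycle at a point to a polynomial family of cocycles. -/

section CocycleLifting

/-- A middle term that is exact for linear maps of vector spaces is split by a homotopy. -/
lemma exists_homotopy_of_exact {k W₀ W₁ W₂ : Type*} [Field k] [AddCommGroup W₀] [Module k W₀]
    [AddCommGroup W₁] [Module k W₁] [AddCommGroup W₂] [Module k W₂]
    {p : W₀ →ₗ[k] W₁} {q : W₁ →ₗ[k] W₂} (h : LinearMap.ker q ≤ LinearMap.range p) :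
    ∃ (g : W₁ →ₗ[k] W₀) (s : W₂ →ₗ[k] W₁), p ∘ₗ g + s ∘ₗ q = LinearMap.id := by
  obtain ⟨r, hr⟩ := q.rangeRestrict.exists_rightInverse_of_surjective q.range_rangeRestrict
  obtain ⟨s, hs⟩ := LinearMap.exists_extend r
  have hqs : ∀ x, q (s (q x)) = q x := by
    intro x
    have h1 : s (q x) = r (q.rangeRestrict x) := LinearMap.congr_fun hs (q.rangeRestrict x)
    have h2 := congrArg Subtype.val (LinearMap.congr_fun hr (q.rangeRestrict x))
    rw [h1]
    exact h2
  have hφ : ∀ x, (LinearMap.id - s ∘ₗ q : W₁ →ₗ[k] W₁) x ∈ LinearMap.range p := fun x => h (by simp [hqs])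
  obtain ⟨g, hg⟩ := Module.projective_lifting_property p.rangeRestrict
    ((LinearMap.id - s ∘ₗ q : W₁ →ₗ[k] W₁).codRestrict _ hφ) p.surjective_rangeRestrict
  refine ⟨g, s, LinearMap.ext fun x => ?_⟩
  have h1 : p (g x) = x - s (q x) := congrArg Subtype.val (LinearMap.congr_fun hg x)
  simp [h1]

/-- If a complex of free modules `S^a → S^b → S^c` becomes exact at the middle after a base
change `ε` to a field, then the cocycles of the base change at `S^a` lift. -/
lemma exists_lift_mulVec_eq_zero {k S ι₀ ι₁ ι₂ : Type*} [Field k] [CommRing S] [Fintype ι₀]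
    [Fintype ι₁] [Fintype ι₂] [DecidableEq ι₀] [DecidableEq ι₁] {ε : S →+* k} {s : k →+* S}
    (hs : ε.comp s = RingHom.id k) {P : Matrix ι₁ ι₀ S} {Q : Matrix ι₂ ι₁ S} (hQP : Q * P = 0)
    {g : Matrix ι₀ ι₁ k} {h : Matrix ι₁ ι₂ k} (hgh : P.map ε * g + h * Q.map ε = 1)
    {a : ι₀ → k} (ha : (P.map ε).mulVec a = 0) :
    ∃ b : ι₀ → S, P.mulVec b = 0 ∧ ε ∘ b = a := by
  have hss : ∀ x, ε (s x) = x := fun x => RingHom.congr_fun hs x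
  let G := g.map s
  let H := h.map s
  let U := P * G + H * Q
  let W := G * P
  -- U lifts the homotopy identity at the point, so it specializes to 1. It is not inverted; its
  -- characteristic polynomial is used in place of a localization.
  have hG : G.map ε = g := by ext; simp [G, hss]
  have hH : H.map ε = h := by ext; simp [H, hss]
  have hU : U.map ε = 1 := by
    rw [← hgh, Matrix.map_add _ (map_add ε), Matrix.map_mul, Matrix.map_mul, hG, hH]
  -- Since QP = 0, f(U) P = P f(W) for every polynomial f; with f the characteristic polynomial χ of
  -- U, Cayley–Hamilton gives P χ(W) = 0.
  have hUP : U * P = P * W := by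
    simp only [U, W, Matrix.add_mul, Matrix.mul_assoc, hQP, Matrix.mul_zero, add_zero]
  have hpow : ∀ N : ℕ, U ^ N * P = P * W ^ N := by
    intro N
    induction N with
    | zero => simp
    | succ N ih => rw [pow_succ, Matrix.mul_assoc, hUP, ← Matrix.mul_assoc, ih, Matrix.mul_assoc,
        ← pow_succ]
  have haeval : ∀ f : Polynomial S, Polynomial.aeval U f * P = P * Polynomial.aeval W f := by
    intro f
    induction f using Polynomial.induction_on' with
    | add f g hf hg => rw [map_add, map_add, Matrix.add_mul, Matrix.mul_add, hf, hg]
    | monomial N c =>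
      rw [Polynomial.aeval_monomial, Polynomial.aeval_monomial, ← Algebra.smul_def,
        ← Algebra.smul_def, Matrix.smul_mul, Matrix.mul_smul, hpow]
  have hWa : (W.map ε).mulVec a = 0 := by
    rw [Matrix.map_mul, ← Matrix.mulVec_mulVec, ha, Matrix.mulVec_zero]
  have hpowa : ∀ N : ℕ, ((W ^ (N + 1)).map ε).mulVec a = 0 := by
    intro N
    rw [pow_succ, Matrix.map_mul, ← Matrix.mulVec_mulVec, hWa, Matrix.mulVec_zero]
  have hval : ∀ f : Polynomial S, ((Polynomial.aeval W f).map ε).mulVec a = ε (f.eval 0) • a := by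
    intro f
    induction f using Polynomial.induction_on' with
    | add f g hf hg =>
      rw [map_add, Matrix.map_add _ (map_add ε), Matrix.add_mulVec, hf, hg, Polynomial.eval_add,
        map_add, add_smul]
    | monomial N c =>
      rw [Polynomial.aeval_monomial, ← Algebra.smul_def, Polynomial.eval_monomial]
      have hmap : (c • W ^ N).map ε = ε c • (W ^ N).map ε := by ext; simp
      rw [hmap, Matrix.smul_mulVec]
      cases N with
      | zero => simp [Matrix.map_one]
      | succ N => rw [hpowa]; simp
  have hχ : ε (U.charpoly.eval 0) = (-1) ^ Fintype.card ι₁ := by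
    rw [← Polynomial.eval_map_apply, ← Matrix.charpoly_map]
    rw [hU, map_zero]
    simp [Matrix.charpoly_one]
  -- By the above χ(W) maps everything to cocycles. At the point W kills a, so χ(W) acts on a by its
  -- constant term χ(0), which specializes to the sign removed here.
  refine ⟨(-1 : S) ^ Fintype.card ι₁ • (Polynomial.aeval W U.charpoly).mulVec (s ∘ a), ?_, ?_⟩
  · rw [Matrix.mulVec_smul, Matrix.mulVec_mulVec, ← haeval, Matrix.aeval_self_charpoly,
      Matrix.zero_mul, Matrix.zero_mulVec, smul_zero]
  · have h1 : ε ∘ (Polynomial.aeval W U.charpoly).mulVec (s ∘ a)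
        = ((Polynomial.aeval W U.charpoly).map ε).mulVec a := by
      ext i
      rw [Function.comp_apply, RingHom.map_mulVec]
      congr 1
      ext; simp [hss]
    have h2 : ε ∘ ((-1 : S) ^ Fintype.card ι₁ • (Polynomial.aeval W U.charpoly).mulVec (s ∘ a))
        = (-1 : k) ^ Fintype.card ι₁ • (ε ∘ (Polynomial.aeval W U.charpoly).mulVec (s ∘ a)) := by
      ext i; simp
    rw [h2, h1, hval, hχ, smul_smul, ← mul_pow]
    simp

/-- The diagonal is assumed to vanish separately, so that characteristic 2 is covered. -/
lemma sum_sum_eq_zero_of_antisymm {ι N : Type*} [AddCommGroup N] (S : Finset ι)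
    {b : ι → ι → N} (h0 : ∀ i, b i i = 0) (h1 : ∀ i j, b i j + b j i = 0) :
    ∑ i ∈ S, ∑ j ∈ S, b i j = 0 := by
  classical
  induction S using Finset.induction_on with
  | empty => simp
  | insert i S hi ih =>
    simp only [Finset.sum_insert hi, Finset.sum_add_distrib, ih, h0, zero_add, add_zero]
    rw [← Finset.sum_add_distrib]
    exact Finset.sum_eq_zero fun j _ => h1 i j

/-- A family of complexes depending linearly on a parameter `v`: if the cohomology in the middle
vanishes at `v`, then a cocycle at `v` in the degree below is the value at `v` of a
polynomial family of cocycles. -/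
theorem exists_polynomial_cocycle {k α W₀ W₁ W₂ : Type*} [Field k] [Fintype α] [DecidableEq α]
    [AddCommGroup W₀] [Module k W₀] [AddCommGroup W₁] [Module k W₁] [AddCommGroup W₂] [Module k W₂]
    [FiniteDimensional k W₀] [FiniteDimensional k W₁] [FiniteDimensional k W₂]
    (R : α → W₀ →ₗ[k] W₁) (R' : α → W₁ →ₗ[k] W₂)
    (h0 : ∀ i, R' i ∘ₗ R i = 0) (h1 : ∀ i j, R' i ∘ₗ R j + R' j ∘ₗ R i = 0) (v : α → k)
    (hv : LinearMap.ker (∑ i, v i • R' i) ≤ LinearMap.range (∑ i, v i • R i))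
    {a : W₀} (ha : (∑ i, v i • R i) a = 0) :
    ∃ (T : Finset (α →₀ ℕ)) (F : (α →₀ ℕ) → W₀), (∀ m ∉ T, F m = 0) ∧
      (∀ m, ∑ i, (if m i = 0 then 0 else R i (F (m - Finsupp.single i 1))) = 0) ∧
      ∑ m ∈ T, (∏ i, v i ^ m i) • F m = a := by
  classical
  let b₀ := Module.finBasis k W₀
  let b₁ := Module.finBasis k W₁
  let b₂ := Module.finBasis k W₂
  obtain ⟨g, s, hgs⟩ := exists_homotopy_of_exact hv
  let C : k →+* MvPolynomial α k := MvPolynomial.C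
  have hC : ∀ c, C c = MvPolynomial.C c := fun _ => rfl
  let P : Matrix _ _ (MvPolynomial α k) :=
    ∑ i, (MvPolynomial.X i : MvPolynomial α k) • (LinearMap.toMatrix b₀ b₁ (R i)).map C
  let Q : Matrix _ _ (MvPolynomial α k) :=
    ∑ i, (MvPolynomial.X i : MvPolynomial α k) • (LinearMap.toMatrix b₁ b₂ (R' i)).map C
  have hP : P.map (MvPolynomial.eval v) = LinearMap.toMatrix b₀ b₁ (∑ i, v i • R i) := by
    ext i j; simp [P, hC, Matrix.sum_apply]
  have hQ : Q.map (MvPolynomial.eval v) = LinearMap.toMatrix b₁ b₂ (∑ i, v i • R' i) := by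
    ext i j; simp [Q, hC, Matrix.sum_apply]
  have hmul : ∀ i j, (LinearMap.toMatrix b₁ b₂ (R' i)).map C *
      (LinearMap.toMatrix b₀ b₁ (R j)).map C
      = (LinearMap.toMatrix b₀ b₂ (R' i ∘ₗ R j)).map C := by
    intro i j
    rw [LinearMap.toMatrix_comp b₀ b₁ b₂, Matrix.map_mul]
  have hQP : Q * P = 0 := by
    simp only [P, Q, Matrix.sum_mul, Matrix.mul_sum, Matrix.smul_mul, Matrix.mul_smul, hmul, Finset.smul_sum]
    refine sum_sum_eq_zero_of_antisymm _ (fun i => ?_) (fun i j => ?_)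
    · rw [h0]; ext; simp
    · rw [smul_smul, smul_smul, mul_comm, ← smul_add, ← Matrix.map_add _ (map_add _),
        ← map_add, add_comm, h1]
      ext; simp
  obtain ⟨c, hc1, hc2⟩ := exists_lift_mulVec_eq_zero (ε := MvPolynomial.eval v)
    (s := C) (by ext; simp [hC]) hQP (g := LinearMap.toMatrix b₁ b₀ g)
    (h := LinearMap.toMatrix b₂ b₁ s)
    (by rw [hP, hQ, ← LinearMap.toMatrix_comp, ← LinearMap.toMatrix_comp, ← map_add, hgs,
      LinearMap.toMatrix_id])
    (a := b₀.repr a) (by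
      rw [hP, LinearMap.toMatrix_mulVec_repr, ha]; simp)
  let F : (α →₀ ℕ) → W₀ := fun m => ∑ j, MvPolynomial.coeff m (c j) • b₀ j
  refine ⟨Finset.univ.biUnion fun j => (c j).support, F, ?_, ?_, ?_⟩
  · intro m hm
    simp only [Finset.mem_biUnion, Finset.mem_univ, true_and, not_exists,
      MvPolynomial.notMem_support_iff] at hm
    simp [F, hm]
  · intro m
    apply b₁.repr.injective
    ext l
    have h2 := congrArg (MvPolynomial.coeff m) (congrFun hc1 l)
    rw [map_zero, Finsupp.zero_apply]
    refine Eq.trans ?_ (h2.trans (by simp))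
    simp only [Matrix.mulVec, dotProduct, P, Matrix.sum_apply, Matrix.smul_apply, Matrix.map_apply,
      smul_eq_mul, hC, Finset.sum_mul, MvPolynomial.coeff_sum]
    rw [Finset.sum_comm, map_sum, Finsupp.finsetSum_apply]
    refine Finset.sum_congr rfl fun i _ => ?_
    by_cases hmi : m i = 0
    · simp [hmi, mul_assoc, MvPolynomial.coeff_X_mul']
    · simp only [hmi, if_false, F, map_sum, map_smul, mul_assoc, MvPolynomial.coeff_X_mul',
        Finsupp.mem_support_iff, ne_eq, not_false_eq_true, if_true, MvPolynomial.coeff_C_mul,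
        Finsupp.finsetSum_apply, Finsupp.smul_apply, smul_eq_mul, LinearMap.toMatrix_apply]
      exact Finset.sum_congr rfl fun j _ => mul_comm _ _
  · have h3 : ∀ j, ∑ m ∈ Finset.univ.biUnion (fun j => (c j).support),
        (∏ i, v i ^ m i) * MvPolynomial.coeff m (c j) = b₀.repr a j := by
      intro j
      rw [← congrFun hc2 j, Function.comp_apply, MvPolynomial.eval_eq']
      symm
      refine Finset.sum_subset_zero_on_sdiff (Finset.subset_biUnion_of_mem (fun j => (c j).support) (Finset.mem_univ j))
        (fun m hm => ?_) (fun m _ => mul_comm _ _)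
      rw [MvPolynomial.notMem_support_iff.mp (Finset.mem_sdiff.mp hm).2, mul_zero]
    simp only [F, Finset.smul_sum, smul_smul]
    rw [Finset.sum_comm]
    conv_rhs => rw [← b₀.sum_repr a]
    refine Finset.sum_congr rfl fun j _ => ?_
    rw [← Finset.sum_smul, h3]

end CocycleLifting

/-! ### Graded algebras with a boundary map -/

section BoundaryAlgebra

/-- The properties of the Orlik-Solomon algebra, with `φ : k^n → A` the natural map,
`Gr` the grading and `D` the boundary, that the comparison with its projective version uses. -/
structure IsBoundaryAlgebra {k : Type*} [Field k] {n : ℕ} {A : Type*} [Ring A] [Algebra k A]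
    (φ : (Fin n → k) →ₗ[k] A) (Gr : ℕ → Submodule k A) (D : A →ₗ[k] A) : Prop where
  boundary_mul : ∀ v x, D (φ v * x) = coordSum k n v • x - φ v * D x
  boundary_one : D 1 = 0
  boundary_boundary : ∀ x, D (D x) = 0
  sq_eq_zero : ∀ v, φ v * φ v = 0
  mul_mem_gr : ∀ p v x, x ∈ Gr p → φ v * x ∈ Gr (p + 1)
  boundary_mem : ∀ p x, x ∈ Gr (p + 1) → D x ∈ Gr p
  boundary_eq_zero : ∀ x, x ∈ Gr 0 → D x = 0
  supercomm : ∀ p v x, x ∈ Gr p → x * φ v = (-1 : k) ^ p • (φ v * x)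
  generated : ∀ K : Submodule k A, 1 ∈ K → (∀ v, ∀ x ∈ K, φ v * x ∈ K) → ∀ x, x ∈ K

namespace IsBoundaryAlgebra

variable {k : Type*} [Field k] {n : ℕ} {A : Type*} [Ring A] [Algebra k A]
  {φ : (Fin n → k) →ₗ[k] A} {Gr : ℕ → Submodule k A} {D : A →ₗ[k] A}

/-- The subalgebra generated by the vectors with coordinate sum zero. -/
abbrev proj (φ : (Fin n → k) →ₗ[k] A) : Subalgebra k A :=
  Algebra.adjoin k (φ '' (sumZero k n : Set (Fin n → k)))

/-- The average of the basis vectors. -/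
def average (k : Type*) [Field k] (n : ℕ) : Fin n → k := fun _ => (n : k)⁻¹

lemma coordSum_average (hn : (n : k) ≠ 0) : coordSum k n (average k n) = 1 := by
  simp [coordSum, average, hn]

lemma mul_swap (H : IsBoundaryAlgebra φ Gr D) (v w : Fin n → k) (x : A) :
    φ v * (φ w * x) = -(φ w * (φ v * x)) := by
  have h := H.sq_eq_zero (v + w)
  rw [map_add, add_mul, mul_add, mul_add, H.sq_eq_zero, H.sq_eq_zero, zero_add, add_zero] at h
  rw [← mul_assoc, ← mul_assoc, eq_neg_of_add_eq_zero_left h, neg_mul]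

lemma mul_self_mul (H : IsBoundaryAlgebra φ Gr D) (v : Fin n → k) (x : A) :
    φ v * (φ v * x) = 0 := by
  rw [← mul_assoc, H.sq_eq_zero, zero_mul]

lemma boundary_mul_of_sumZero (H : IsBoundaryAlgebra φ Gr D) {v : Fin n → k}
    (hv : v ∈ sumZero k n) (x : A) : D (φ v * x) = -(φ v * D x) := by
  rw [H.boundary_mul, show coordSum k n v = 0 from hv, zero_smul, zero_sub]

lemma boundary_average_mul (H : IsBoundaryAlgebra φ Gr D) (hn : (n : k) ≠ 0) (x : A) :
    D (φ (average k n) * x) = x - φ (average k n) * D x := by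
  rw [H.boundary_mul, coordSum_average hn, one_smul]

/-- The boundary commutes with right multiplication by vectors of coordinate sum zero. -/
lemma boundary_mul_right (H : IsBoundaryAlgebra φ Gr D) {v : Fin n → k}
    (hv : v ∈ sumZero k n) (x : A) : D (x * φ v) = D x * φ v := by
  refine H.generated (LinearMap.eqLocus (D ∘ₗ LinearMap.mulRight k (φ v))
    (LinearMap.mulRight k (φ v) ∘ₗ D)) ?_ ?_ x
  · have := H.boundary_mul_of_sumZero hv 1
    simp only [H.boundary_one, mul_one, mul_zero, neg_zero] at this
    simp [LinearMap.mem_eqLocus, H.boundary_one, this]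
  · intro w x hx
    simp only [LinearMap.mem_eqLocus, LinearMap.comp_apply, LinearMap.mulRight_apply] at hx ⊢
    rw [mul_assoc, H.boundary_mul, H.boundary_mul, hx, sub_mul, mul_assoc, smul_mul_assoc]

lemma boundary_eq_zero_of_mem_proj (H : IsBoundaryAlgebra φ Gr D) {x : A} (hx : x ∈ proj φ) :
    D x = 0 := by
  suffices ∀ y, D y = 0 → D (x * y) = 0 by simpa using this 1 H.boundary_one
  induction hx using Algebra.adjoin_induction with
  | mem x hx =>
    obtain ⟨v, hv, rfl⟩ := hx
    intro y hy
    rw [H.boundary_mul_of_sumZero hv, hy, mul_zero, neg_zero]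
  | algebraMap r => intro y hy; rw [← Algebra.smul_def, map_smul, hy, smul_zero]
  | add x y _ _ hx hy => intro z hz; rw [add_mul, map_add, hx z hz, hy z hz, add_zero]
  | mul x y _ _ hx hy => intro z hz; rw [mul_assoc]; exact hx _ (hy z hz)

/-- The projective subalgebra is the kernel of the boundary. -/
lemma mem_proj_iff (H : IsBoundaryAlgebra φ Gr D) (hn : (n : k) ≠ 0) {x : A} :
    x ∈ proj φ ↔ D x = 0 := by
  refine ⟨H.boundary_eq_zero_of_mem_proj, fun hx => ?_⟩
  -- Ā + cĀ contains 1 and is stable under V = V̄ ⊕ kc, hence is all of A. On a + cb with a and b in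
  -- Ā, the boundary is b.
  have h : x ∈ Subalgebra.toSubmodule (proj φ) ⊔ (Subalgebra.toSubmodule (proj φ)).map
      (LinearMap.mulLeft k (φ (average k n))) := by
    refine H.generated _ (Submodule.mem_sup_left (one_mem (proj φ))) ?_ x
    intro v x hx
    obtain ⟨a, ha, _, ⟨b, hb, rfl⟩, rfl⟩ := Submodule.mem_sup.mp hx
    set w := v - coordSum k n v • average k n with hw
    have hw0 : w ∈ sumZero k n := by
      change coordSum k n w = 0
      rw [hw, map_sub, map_smul, coordSum_average hn]
      simp
    have hmem : ∀ y ∈ proj φ, φ w * y ∈ proj φ := fun y hy =>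
      mul_mem (Algebra.subset_adjoin ⟨w, hw0, rfl⟩) hy
    have hv : v = w + coordSum k n v • average k n := by rw [hw]; abel
    have hφ : φ v = φ w + coordSum k n v • φ (average k n) := by
      rw [← map_smul, ← map_add, ← hv]
    refine Submodule.mem_sup.mpr ⟨φ w * a, hmem a ha,
      φ (average k n) * (coordSum k n v • a - φ w * b),
      ⟨_, sub_mem ((proj φ).smul_mem ha _) (hmem b hb), rfl⟩, ?_⟩
    rw [hφ, LinearMap.mulLeft_apply, add_mul, mul_add, mul_add, H.mul_swap w,
      smul_mul_assoc, smul_mul_assoc, H.mul_self_mul, mul_sub, mul_smul_comm]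
    simp only [smul_zero, add_zero]
    abel
  obtain ⟨a, ha, _, ⟨b, hb, rfl⟩, rfl⟩ := Submodule.mem_sup.mp h
  rw [map_add, H.boundary_eq_zero_of_mem_proj ha, LinearMap.mulLeft_apply,
    H.boundary_average_mul hn, H.boundary_eq_zero_of_mem_proj hb] at hx
  simp only [mul_zero, sub_zero, zero_add] at hx
  rw [hx, LinearMap.mulLeft_apply, mul_zero, add_zero]
  exact ha

/-! #### Degrees indexed by the integers -/

lemma eq_zero_of_mem_extendByZero {p : ℤ} (hp : p < 0) {x : A}
    (hx : x ∈ extendByZero Gr p) : x = 0 := by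
  obtain ⟨m, rfl⟩ := Int.eq_negSucc_of_lt_zero hp
  exact (Submodule.mem_bot k).mp hx

lemma mem_extendByZero_comap {B : Subalgebra k A} {p : ℤ} {x : B} :
    x ∈ extendByZero (fun p => (Gr p).comap B.val.toLinearMap) p ↔
      (x : A) ∈ extendByZero Gr p := by
  cases p with
  | ofNat p => exact Iff.rfl
  | negSucc p =>
    simp only [extendByZero, Submodule.mem_bot]
    exact (ZeroMemClass.coe_eq_zero (x := x)).symm

lemma mul_mem_extendByZero (H : IsBoundaryAlgebra φ Gr D) {p : ℤ} (v : Fin n → k) {x : A}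
    (hx : x ∈ extendByZero Gr p) : φ v * x ∈ extendByZero Gr (p + 1) := by
  cases p with
  | ofNat p => exact H.mul_mem_gr p v x hx
  | negSucc p =>
    rw [eq_zero_of_mem_extendByZero (Int.negSucc_lt_zero p) hx, mul_zero]
    exact zero_mem _

lemma boundary_mem_extendByZero (H : IsBoundaryAlgebra φ Gr D) {p : ℤ} {x : A}
    (hx : x ∈ extendByZero Gr p) : D x ∈ extendByZero Gr (p - 1) := by
  match p, hx with
  | Int.ofNat 0, hx => rw [H.boundary_eq_zero x hx]; exact zero_mem _
  | Int.ofNat (p + 1), hx =>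
    have : (Int.ofNat (p + 1)) - 1 = Int.ofNat p := by simp
    rw [this]
    exact H.boundary_mem p x hx
  | Int.negSucc p, hx =>
    rw [eq_zero_of_mem_extendByZero (Int.negSucc_lt_zero p) hx, map_zero]
    exact zero_mem _

lemma mul_average_mem_extendByZero (H : IsBoundaryAlgebra φ Gr D) {p : ℤ} {x : A}
    (hx : x ∈ extendByZero Gr (p - 1)) :
    φ (average k n) * x ∈ extendByZero Gr p := by
  simpa using H.mul_mem_extendByZero (average k n) hx

lemma exists_sign (H : IsBoundaryAlgebra φ Gr D) {p : ℤ} {x : A} (hx : x ∈ extendByZero Gr p) :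
    ∃ c : k, c ≠ 0 ∧ ∀ v, x * φ v = c • (φ v * x) := by
  cases p with
  | ofNat p => exact ⟨(-1) ^ p, by simp, fun v => H.supercomm p v x hx⟩
  | negSucc p =>
    rw [eq_zero_of_mem_extendByZero (Int.negSucc_lt_zero p) hx]
    exact ⟨1, one_ne_zero, fun v => by simp⟩

/-! #### Comparison of cohomology -/

lemma one_le_rank_cochainCohomology_iff {G : ℤ → Submodule k A} {δ : A →ₗ[k] A} {p : ℤ} :
    ((1 : ℕ) : Cardinal) ≤ Module.rank k (cochainCohomology G δ p) ↔
      ∃ z ∈ G p, δ z = 0 ∧ z ∉ (G (p - 1)).map δ := by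
  rw [Nat.cast_one, Cardinal.one_le_iff_ne_zero, ne_eq, rank_zero_iff,
    Submodule.Quotient.subsingleton_iff, Submodule.eq_top_iff']
  push Not
  constructor
  · rintro ⟨⟨z, hz, hδ⟩, h⟩
    exact ⟨z, hz, hδ, h⟩
  · rintro ⟨z, hz, hδ, h⟩
    exact ⟨⟨z, hz, hδ⟩, h⟩

lemma mem_rightMulAction {B : Type*} [Ring B] [Algebra k B] {V : Type*} [AddCommGroup V]
    [Module k V] (ψ : V →ₗ[k] B) (v : V) (x : B) : rightMulAction ψ v x = x * ψ v := rfl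

/-- Off the hyperplane of vectors of coordinate sum zero the complex is acyclic. -/
lemma mem_map_of_not_sumZero (H : IsBoundaryAlgebra φ Gr D) {v : Fin n → k}
    (hv : v ∉ sumZero k n) {p : ℤ} {x : A} (hx : x ∈ extendByZero Gr p)
    (hxv : x * φ v = 0) :
    x ∈ (extendByZero Gr (p - 1)).map (rightMulAction φ v) := by
  have hs : coordSum k n v ≠ 0 := hv
  obtain ⟨c, hc, hcv⟩ := H.exists_sign hx
  have h1 : φ v * x = 0 := by
    have := hcv v
    rw [hxv] at this
    exact (smul_eq_zero.mp this.symm).resolve_left hc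
  -- With s the coordinate sum of v, ∂(vx) = s x - v ∂x; as vx = 0, x = s⁻¹ v ∂x.
  have h2 := H.boundary_mul v x
  rw [h1, map_zero] at h2
  have hDx := H.boundary_mem_extendByZero hx
  obtain ⟨c', hc', hcv'⟩ := H.exists_sign hDx
  refine ⟨((coordSum k n v)⁻¹ * c'⁻¹) • D x, Submodule.smul_mem _ _ hDx, ?_⟩
  rw [mem_rightMulAction, smul_mul_assoc, hcv', smul_smul, mul_assoc, inv_mul_cancel₀ hc', mul_one,
    ← sub_eq_zero.mp h2.symm, smul_smul, inv_mul_cancel₀ hs, one_smul]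

variable {ψ : sumZero k n →ₗ[k] proj φ}

/-- The grading of the projective subalgebra. -/
abbrev projGr (φ : (Fin n → k) →ₗ[k] A) (Gr : ℕ → Submodule k A) : ℕ → Submodule k (proj φ) :=
  fun p => (Gr p).comap (proj φ).val.toLinearMap

lemma _root_.rank_quotient_eq_add.{u} {Z X Y : Type u} [AddCommGroup Z] [Module k Z]
    [AddCommGroup X] [Module k X] [AddCommGroup Y] [Module k Y] {N : Submodule k Z}
    (f : Z →ₗ[k] X × Y) (hf : Function.Surjective f) (hN : LinearMap.ker f = N) :
    Module.rank k (Z ⧸ N) = Module.rank k X + Module.rank k Y := by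
  rw [← rank_prod']
  exact LinearEquiv.rank_eq ((Submodule.quotEquivOfEq _ _ hN.symm).trans
    (f.quotKerEquivOfSurjective hf))

/-- The cohomology of `A` is the sum of the cohomology of the projective subalgebra and its
shift. -/
lemma rank_cochainCohomology (H : IsBoundaryAlgebra φ Gr D) (hn : (n : k) ≠ 0)
    (hψ : ∀ v, (ψ v : A) = φ v) (v : sumZero k n) (p : ℤ) :
    Module.rank k (cochainCohomology (extendByZero Gr) (rightMulAction φ v) p) =
      Module.rank k
        (cochainCohomology (extendByZero (projGr φ Gr)) (rightMulAction ψ v) p) +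
      Module.rank k
        (cochainCohomology (extendByZero (projGr φ Gr)) (rightMulAction ψ v) (p - 1)) := by
  -- The isomorphism is induced by x ↦ (x - c∂x, ∂x), with inverse (a, b) ↦ a + cb. Multiplication
  -- by c is on the left and v acts on the right, so no signs occur.
  have hD : ∀ x, D x ∈ proj φ := fun x => (H.mem_proj_iff hn).mpr (H.boundary_boundary x)
  have hN : ∀ x, x - φ (average k n) * D x ∈ proj φ := fun x => (H.mem_proj_iff hn).mpr (by
    rw [map_sub, H.boundary_average_mul hn, H.boundary_boundary]; simp)
  have hNv : ∀ x, (x - φ (average k n) * D x) * φ v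
      = x * φ v - φ (average k n) * D (x * φ v) := fun x => by
    rw [H.boundary_mul_right v.2, sub_mul, mul_assoc]
  have hψ' : ∀ x : proj φ, ((rightMulAction ψ v x : proj φ) : A) = (x : A) * φ v := fun x => by
    rw [mem_rightMulAction, MulMemClass.coe_mul, hψ]
  let β₀ : A →ₗ[k] proj φ := D.codRestrict (Subalgebra.toSubmodule (proj φ)) hD
  let α₀ : A →ₗ[k] proj φ :=
    (LinearMap.id - LinearMap.mulLeft k (φ (average k n)) ∘ₗ D).codRestrict
      (Subalgebra.toSubmodule (proj φ)) hN
  have hα₀ : ∀ x, ((α₀ x : proj φ) : A) = x - φ (average k n) * D x := fun _ => rfl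
  have hβ₀ : ∀ x, ((β₀ x : proj φ) : A) = D x := fun _ => rfl
  have hαdeg : ∀ {p : ℤ} {x : A}, x ∈ extendByZero Gr p →
      α₀ x ∈ extendByZero (projGr φ Gr) p := fun {p x} hx =>
    mem_extendByZero_comap.mpr (sub_mem hx
      (H.mul_average_mem_extendByZero (H.boundary_mem_extendByZero hx)))
  have hβdeg : ∀ {p : ℤ} {x : A}, x ∈ extendByZero Gr p →
      β₀ x ∈ extendByZero (projGr φ Gr) (p - 1) := fun {p x} hx =>
    mem_extendByZero_comap.mpr (H.boundary_mem_extendByZero hx)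
  have hαv : ∀ x, rightMulAction ψ v (α₀ x) = α₀ (x * φ v) := fun x => Subtype.ext (by
    rw [hψ', hα₀, hα₀, hNv])
  have hβv : ∀ x, rightMulAction ψ v (β₀ x) = β₀ (x * φ v) := fun x => Subtype.ext (by
    rw [hψ', hβ₀, hβ₀, H.boundary_mul_right v.2])
  let Z := extendByZero Gr p ⊓ LinearMap.ker (rightMulAction φ (v : Fin n → k))
  let α : Z →ₗ[k] ↥(extendByZero (projGr φ Gr) p ⊓ LinearMap.ker (rightMulAction ψ v)) :=
    (α₀ ∘ₗ Z.subtype).codRestrict _ fun z => ⟨hαdeg z.2.1, by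
      have hz : (z : A) * φ v = 0 := z.2.2
      change rightMulAction ψ v (α₀ z) = 0
      rw [hαv, hz, map_zero]⟩
  let β : Z →ₗ[k] ↥(extendByZero (projGr φ Gr) (p - 1) ⊓ LinearMap.ker (rightMulAction ψ v)) :=
    (β₀ ∘ₗ Z.subtype).codRestrict _ fun z => ⟨hβdeg z.2.1, by
      have hz : (z : A) * φ v = 0 := z.2.2
      change rightMulAction ψ v (β₀ z) = 0
      rw [hβv, hz, map_zero]⟩
  let f : Z →ₗ[k] cochainCohomology (extendByZero (projGr φ Gr)) (rightMulAction ψ v) p ×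
      cochainCohomology (extendByZero (projGr φ Gr)) (rightMulAction ψ v) (p - 1) :=
    (Submodule.mkQ _ ∘ₗ α).prod (Submodule.mkQ _ ∘ₗ β)
  have hsurj : Function.Surjective f := by
    rintro ⟨a, b⟩
    obtain ⟨⟨a, ha, ha'⟩, rfl⟩ := Submodule.mkQ_surjective _ a
    obtain ⟨⟨b, hb, hb'⟩, rfl⟩ := Submodule.mkQ_surjective _ b
    rw [SetLike.mem_coe, mem_extendByZero_comap] at ha hb
    have ha0 : (a : A) * φ v = 0 := by
      rw [← hψ', show rightMulAction ψ v a = 0 from ha']; rfl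
    have hb0 : (b : A) * φ v = 0 := by
      rw [← hψ', show rightMulAction ψ v b = 0 from hb']; rfl
    have hDab : D ((a : A) + φ (average k n) * b) = b := by
      rw [map_add, H.boundary_average_mul hn, H.boundary_eq_zero_of_mem_proj a.2,
        H.boundary_eq_zero_of_mem_proj b.2]
      simp
    refine ⟨⟨(a : A) + φ (average k n) * b,
      add_mem ha (H.mul_average_mem_extendByZero hb), ?_⟩, ?_⟩
    · change ((a : A) + φ (average k n) * b) * φ v = 0
      rw [add_mul, mul_assoc, ha0, hb0, mul_zero, add_zero]
    · refine Prod.ext ?_ ?_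
      · change Submodule.mkQ _ (α _) = Submodule.mkQ _ _
        congr 1
        refine Subtype.ext (Subtype.ext ?_)
        change (a : A) + φ (average k n) * b -
          φ (average k n) * D ((a : A) + φ (average k n) * b) = a
        rw [hDab, add_sub_cancel_right]
      · change Submodule.mkQ _ (β _) = Submodule.mkQ _ _
        congr 1
        exact Subtype.ext (Subtype.ext hDab)
  have hker : LinearMap.ker f = ((extendByZero Gr (p - 1)).map
      (rightMulAction φ (v : Fin n → k))).comap Z.subtype := by
    ext z
    rw [LinearMap.ker_prod, Submodule.mem_inf, LinearMap.mem_ker, LinearMap.mem_ker,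
      LinearMap.comp_apply, LinearMap.comp_apply, Submodule.mkQ_apply, Submodule.mkQ_apply,
      Submodule.Quotient.mk_eq_zero, Submodule.Quotient.mk_eq_zero]
    constructor
    · rintro ⟨⟨c, hc, hcz⟩, ⟨c', hc', hcz'⟩⟩
      rw [SetLike.mem_coe, mem_extendByZero_comap] at hc hc'
      have h1 : (c : A) * φ v = z - φ (average k n) * D z := by
        rw [← hψ', hcz]; rfl
      have h2 : (c' : A) * φ v = D z := by
        rw [← hψ', hcz']; rfl
      refine ⟨(c : A) + φ (average k n) * c',
        add_mem hc (H.mul_average_mem_extendByZero hc'), ?_⟩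
      change ((c : A) + φ (average k n) * c') * φ v = z
      rw [add_mul, mul_assoc, h1, h2, sub_add_cancel]
    · rintro ⟨y, hy, hyz⟩
      have hyz' : y * φ v = z := hyz
      refine ⟨⟨α₀ y, hαdeg hy, ?_⟩, ⟨β₀ y, hβdeg hy, ?_⟩⟩
      · rw [hαv, hyz']; rfl
      · rw [hβv, hyz']; rfl
  exact rank_quotient_eq_add f hsurj hker

/-! #### Resonance varieties -/

/-- If d ≤ a, take j = d; otherwise a is finite and j = a works. No finiteness of the cohomology is
required. -/
lemma _root_.Cardinal.natCast_le_add_iff {a b : Cardinal} {d : ℕ} :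
    (d : Cardinal) ≤ a + b ↔ ∃ j ≤ d, (j : Cardinal) ≤ a ∧ ((d - j : ℕ) : Cardinal) ≤ b := by
  constructor
  · intro h
    by_cases ha : (d : Cardinal) ≤ a
    · exact ⟨d, le_rfl, ha, by simp⟩
    · obtain ⟨i, rfl⟩ := Cardinal.lt_aleph0.mp ((not_le.mp ha).trans Cardinal.natCast_lt_aleph0)
      have hid : i ≤ d := by exact_mod_cast (not_le.mp ha).le
      refine ⟨i, hid, le_rfl, ?_⟩
      by_cases hb : (d : Cardinal) ≤ b
      · exact le_trans (by exact_mod_cast Nat.sub_le d i) hb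
      · obtain ⟨j, rfl⟩ := Cardinal.lt_aleph0.mp ((not_le.mp hb).trans Cardinal.natCast_lt_aleph0)
        have : d ≤ i + j := by exact_mod_cast h
        exact_mod_cast (by omega : d - i ≤ j)
  · rintro ⟨j, hj, ha, hb⟩
    calc (d : Cardinal) = (j : Cardinal) + ((d - j : ℕ) : Cardinal) := by
          rw [← Nat.cast_add, Nat.add_sub_cancel' hj]
      _ ≤ a + b := add_le_add ha hb

/-- The resonance variety of the projective subalgebra, in `k^n`. -/
abbrev projResonance (Gr : ℕ → Submodule k A) (ψ : sumZero k n →ₗ[k] proj φ) (p : ℤ) (d : ℕ) :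
    Set (Fin n → k) :=
  (fun v : sumZero k n => (v : Fin n → k)) ''
    resonance (extendByZero (projGr φ Gr)) (rightMulAction ψ) p d

lemma mem_resonance_iff (H : IsBoundaryAlgebra φ Gr D) (hn : (n : k) ≠ 0)
    (hψ : ∀ v, (ψ v : A) = φ v) (v : sumZero k n) (p : ℤ) (d : ℕ) :
    (v : Fin n → k) ∈ resonance (extendByZero Gr) (rightMulAction φ) p d ↔
      (v : Fin n → k) ∈ ⋃ j : ℕ, ⋃ _ : j ≤ d,
        projResonance Gr ψ p j ∩ projResonance Gr ψ (p - 1) (d - j) := by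
  have hmem : ∀ (p : ℤ) (j : ℕ), (v : Fin n → k) ∈ projResonance Gr ψ p j ↔
      (j : Cardinal) ≤ Module.rank k
        (cochainCohomology (extendByZero (projGr φ Gr)) (rightMulAction ψ v) p) := by
    intro p j
    constructor
    · rintro ⟨w, hw, hwv⟩
      rw [← Subtype.ext hwv]
      exact hw
    · intro h
      exact ⟨v, h, rfl⟩
  simp only [Set.mem_iUnion, Set.mem_inter_iff, hmem, exists_prop]
  change (d : Cardinal) ≤ Module.rank k _ ↔ _
  rw [H.rank_cochainCohomology hn hψ, Cardinal.natCast_le_add_iff]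

lemma mem_sumZero_of_mem_resonance (H : IsBoundaryAlgebra φ Gr D) {v : Fin n → k} {p : ℤ} {d : ℕ}
    (hd : 1 ≤ d) (hv : v ∈ resonance (extendByZero Gr) (rightMulAction φ) p d) :
    v ∈ sumZero k n := by
  by_contra h
  have h1 : ((1 : ℕ) : Cardinal) ≤ Module.rank k
      (cochainCohomology (extendByZero Gr) (rightMulAction φ v) p) :=
    le_trans (Nat.cast_le.mpr hd) hv
  obtain ⟨z, hz, hzv, hz'⟩ := one_le_rank_cochainCohomology_iff.mp h1
  exact hz' (H.mem_map_of_not_sumZero h hz hzv)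

lemma mem_sumZero_of_mem_iUnion {v : Fin n → k} {p : ℤ} {d : ℕ}
    (hv : v ∈ ⋃ j : ℕ, ⋃ _ : j ≤ d,
        projResonance Gr ψ p j ∩ projResonance Gr ψ (p - 1) (d - j)) : v ∈ sumZero k n := by
  simp only [Set.mem_iUnion, Set.mem_inter_iff] at hv
  obtain ⟨j, _, ⟨w, _, rfl⟩, _⟩ := hv
  exact w.2

theorem resonance_eq (H : IsBoundaryAlgebra φ Gr D) (hn : (n : k) ≠ 0)
    (hψ : ∀ v, (ψ v : A) = φ v) (p : ℤ) {d : ℕ} (hd : 1 ≤ d) :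
    resonance (extendByZero Gr) (rightMulAction φ) p d =
      ⋃ j : ℕ, ⋃ _ : j ≤ d, projResonance Gr ψ p j ∩ projResonance Gr ψ (p - 1) (d - j) := by
  ext v
  exact ⟨fun h => (H.mem_resonance_iff hn hψ ⟨v, H.mem_sumZero_of_mem_resonance hd h⟩ p d).mp h,
    fun h => (H.mem_resonance_iff hn hψ ⟨v, mem_sumZero_of_mem_iUnion h⟩ p d).mpr h⟩

theorem resonance_inter_eq (H : IsBoundaryAlgebra φ Gr D) (hn : (n : k) ≠ 0)
    (hψ : ∀ v, (ψ v : A) = φ v) (p : ℤ) (d : ℕ) :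
    resonance (extendByZero Gr) (rightMulAction φ) p d ∩ (sumZero k n : Set (Fin n → k)) =
      ⋃ j : ℕ, ⋃ _ : j ≤ d, projResonance Gr ψ p j ∩ projResonance Gr ψ (p - 1) (d - j) := by
  ext v
  exact ⟨fun h => (H.mem_resonance_iff hn hψ ⟨v, h.2⟩ p d).mp h.1, fun h =>
    ⟨(H.mem_resonance_iff hn hψ ⟨v, mem_sumZero_of_mem_iUnion h⟩ p d).mpr h,
      mem_sumZero_of_mem_iUnion h⟩⟩

end IsBoundaryAlgebra

end BoundaryAlgebra

/-! ### Propagation of resonance in the projective subalgebra -/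

/-- Multiplication by x_i matches the truncation in degrees ≤ N with that in degrees ≤ N + 1, so an
identity of power series can be evaluated at v without convergence. -/
lemma sum_degree_le_smul_shift {α k A : Type*} [Fintype α] [DecidableEq α] [CommSemiring k]
    [AddCommMonoid A] [Module k A] (v : α → k) (N : ℕ) (h : (α →₀ ℕ) → A) (i : α) :
    ∑ m ∈ (Finsupp.finite_of_degree_le (σ := α) (N + 1)).toFinset,
      (∏ j, v j ^ m j) • (if m i = 0 then 0 else h (m - Finsupp.single i 1)) =
    v i • ∑ m ∈ (Finsupp.finite_of_degree_le (σ := α) N).toFinset, (∏ j, v j ^ m j) • h m := by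
  classical
  rw [Finset.smul_sum]
  symm
  refine Finset.sum_of_injOn (fun m => m + Finsupp.single i 1)
    (fun m _ m' _ hm => add_right_cancel hm) ?_ ?_ ?_
  · intro m hm
    simp only [Finset.mem_coe, Set.Finite.mem_toFinset, Set.mem_ofPred_eq] at hm ⊢
    rw [map_add, Finsupp.degree_single]
    omega
  · intro m hm hm'
    rw [if_pos, smul_zero]
    by_contra hi
    have hle : Finsupp.single i 1 ≤ m := by
      rw [Finsupp.single_le_iff]; omega
    have hadd : m - Finsupp.single i 1 + Finsupp.single i 1 = m := tsub_add_cancel_of_le hle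
    refine hm' ⟨m - Finsupp.single i 1, ?_, hadd⟩
    simp only [Finset.mem_coe, Set.Finite.mem_toFinset, Set.mem_ofPred_eq] at hm ⊢
    rw [← hadd, map_add, Finsupp.degree_single] at hm
    omega
  · intro m _
    have hprod : ∏ j, v j ^ (m + Finsupp.single i 1 : α →₀ ℕ) j = v i * ∏ j, v j ^ m j := by
      simp only [Finsupp.add_apply, pow_add, Finset.prod_mul_distrib]
      rw [mul_comm]
      congr 1
      rw [Finset.prod_eq_single i]
      · simp
      · intro j _ hj
        simp [Finsupp.single_eq_of_ne hj]
      · simp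
    rw [hprod, if_neg (by simp), add_tsub_cancel_right, mul_smul]

section BoundaryAlgebra

namespace IsBoundaryAlgebra

variable {k : Type*} [Field k] {n : ℕ} {A : Type*} [Ring A] [Algebra k A]
  {φ : (Fin n → k) →ₗ[k] A} {Gr : ℕ → Submodule k A} {D : A →ₗ[k] A}

lemma mul_right_mem_gr (H : IsBoundaryAlgebra φ Gr D) {p : ℕ} (v : Fin n → k) {x : A}
    (hx : x ∈ Gr p) : x * φ v ∈ Gr (p + 1) := by
  rw [H.supercomm p v x hx]
  exact Submodule.smul_mem _ _ (H.mul_mem_gr p v x hx)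

/-- Right multiplication by a vector of coordinate sum zero, on the homogeneous elements of the
kernel of the boundary. -/
def kerMulRight (H : IsBoundaryAlgebra φ Gr D) (p : ℕ) (v : sumZero k n) :
    ↥(Gr p ⊓ LinearMap.ker D) →ₗ[k] ↥(Gr (p + 1) ⊓ LinearMap.ker D) :=
  (LinearMap.mulRight k (φ v) ∘ₗ (Gr p ⊓ LinearMap.ker D).subtype).codRestrict _ fun x =>
    ⟨H.mul_right_mem_gr v x.2.1, by
      change D ((x : A) * φ v) = 0
      rw [H.boundary_mul_right v.2, show D (x : A) = 0 from x.2.2, zero_mul]⟩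

lemma coe_kerMulRight (H : IsBoundaryAlgebra φ Gr D) (p : ℕ) (v : sumZero k n)
    (x : ↥(Gr p ⊓ LinearMap.ker D)) : (H.kerMulRight p v x : A) = (x : A) * φ v := rfl

/-- The projection of the `i`-th basis vector to the hyperplane of coordinate sum zero. -/
def centered (hn : (n : k) ≠ 0) (i : Fin n) : sumZero k n :=
  ⟨Pi.single i 1 - average k n, by
    change coordSum k n _ = 0
    rw [map_sub, coordSum_average hn]
    simp [coordSum]⟩

lemma sum_smul_single (φ : (Fin n → k) →ₗ[k] A) (v : Fin n → k) :
    ∑ i, v i • φ (Pi.single i 1) = φ v := by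
  conv_rhs => rw [pi_eq_sum_univ' v, map_sum]
  exact Finset.sum_congr rfl fun i _ => by
    rw [← map_smul]

/-- The contributions of c cancel because the coordinates sum to zero. Hence x̄ specializes to v,
just as x does. -/
lemma sum_smul_centered (hn : (n : k) ≠ 0) {v : Fin n → k} (hv : v ∈ sumZero k n) :
    ∑ i, v i • φ (centered hn i) = φ v := by
  have hs : ∑ i, v i = 0 := by
    have : coordSum k n v = 0 := hv
    simpa [coordSum] using this
  simp only [centered, map_sub, smul_sub, Finset.sum_sub_distrib]
  rw [← Finset.sum_smul, hs, zero_smul, sub_zero, sum_smul_single]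

/-- Exactness at `v` in one degree of the projective subalgebra implies exactness in the degree
below, if the Koszul complex of the generic vector is exact. -/
theorem exists_eq_mul_of_exact_succ (H : IsBoundaryAlgebra φ Gr D) [Module.Finite k A]
    (hn : (n : k) ≠ 0) {q : ℕ}
    (hgen : ∀ F : (Fin n →₀ ℕ) → A, (∀ m, F m ∈ Gr (q + 1)) →
      (∀ m, ∑ i, (if m i = 0 then 0 else
        φ (Pi.single i 1) * F (m - Finsupp.single i 1)) = 0) →
      ∃ G : (Fin n →₀ ℕ) → A, (∀ m, G m ∈ Gr q) ∧
        ∀ m, F m = ∑ i, (if m i = 0 then 0 else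
          φ (Pi.single i 1) * G (m - Finsupp.single i 1)))
    {v : Fin n → k} (hv : v ∈ sumZero k n)
    (hex : ∀ x ∈ Gr (q + 1), D x = 0 → x * φ v = 0 → ∃ y ∈ Gr q, D y = 0 ∧ y * φ v = x)
    {a : A} (ha : a ∈ Gr q) (hDa : D a = 0) (hav : a * φ v = 0) :
    ∃ b ∈ extendByZero Gr ((q : ℤ) - 1), D b = 0 ∧ b * φ v = a := by
  have hsum : ∀ (p : ℕ) (x : ↥(Gr p ⊓ LinearMap.ker D)),
      (((∑ i, v i • H.kerMulRight p (centered hn i)) x : ↥(Gr (p + 1) ⊓ LinearMap.ker D)) : A) =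
        (x : A) * φ v := by
    intro p x
    rw [LinearMap.sum_apply, ← sum_smul_centered hn hv, Finset.mul_sum]
    simp [coe_kerMulRight]
  have hmul0 : ∀ (x : A) (v w : Fin n → k), x * φ v * φ w + x * φ w * φ v = 0 := by
    intro x v w
    have := H.mul_swap v w 1
    rw [mul_one, mul_one] at this
    rw [mul_assoc, mul_assoc, this, mul_neg, neg_add_cancel]
  obtain ⟨T, F, hT, hF, hFa⟩ := exists_polynomial_cocycle
    (fun i => H.kerMulRight q (centered hn i)) (fun i => H.kerMulRight (q + 1) (centered hn i))
    (fun i => LinearMap.ext fun x => Subtype.ext (by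
      change (x : A) * _ * _ = 0
      rw [mul_assoc, H.sq_eq_zero, mul_zero]))
    (fun i j => LinearMap.ext fun x => Subtype.ext (hmul0 _ _ _)) v
    (by
      intro x hx
      have hx0 : (x : A) * φ v = 0 := by
        rw [← hsum, LinearMap.mem_ker.mp hx]; rfl
      obtain ⟨y, hy, hDy, hyx⟩ := hex x x.2.1 x.2.2 hx0
      exact ⟨⟨y, hy, hDy⟩, Subtype.ext ((hsum _ _).trans hyx)⟩)
    (a := ⟨a, ha, hDa⟩) (Subtype.ext ((hsum _ _).trans hav))
  set c := average k n with hc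
  have hF1 : ∀ m, ∑ i, (if m i = 0 then 0 else
      φ (centered hn i) * (F (m - Finsupp.single i 1) : A)) = 0 := by
    intro m
    have h := congrArg (Subtype.val : ↥(Gr (q + 1) ⊓ LinearMap.ker D) → A) (hF m)
    have h2 : ∑ i, (if m i = 0 then 0 else
        (F (m - Finsupp.single i 1) : A) * φ (centered hn i)) = 0 := by
      refine Eq.trans ?_ h
      rw [AddSubmonoidClass.coe_finsetSum]
      exact Finset.sum_congr rfl fun i _ => by split_ifs <;> rfl
    -- The values of F all have degree q, so one common sign passes from right to left
    -- multiplication.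
    have h3 : (-1 : k) ^ q • ∑ i, (if m i = 0 then 0 else
        φ (centered hn i) * (F (m - Finsupp.single i 1) : A)) = 0 := by
      refine Eq.trans ?_ h2
      rw [Finset.smul_sum]
      refine Finset.sum_congr rfl fun i _ => ?_
      split_ifs
      · exact smul_zero _
      · exact (H.supercomm q _ _ (F _).2.1).symm
    exact (smul_eq_zero.mp h3).resolve_left (by simp)
  -- cF is a cocycle of the generic vector: e_i differs from its projection by c, and c² = 0.
  obtain ⟨G, hG, hFG⟩ := hgen (fun m => φ c * F m) (fun m => H.mul_mem_gr q _ _ (F m).2.1)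
    (fun m => by
      rw [← neg_eq_zero]
      refine Eq.trans ?_ ((congrArg (φ c * ·) (hF1 m)).trans (mul_zero _))
      rw [Finset.mul_sum, ← Finset.sum_neg_distrib]
      refine Finset.sum_congr rfl fun i _ => ?_
      split_ifs
      · simp
      · have : φ (Pi.single i 1) = φ (centered hn i) + φ c := by
          rw [← map_add]; congr 1; exact (sub_add_cancel _ _).symm
        rw [this, add_mul, H.mul_self_mul, add_zero, H.mul_swap, neg_neg])
  obtain ⟨N, hN⟩ : ∃ N, ∀ m ∈ T, m.degree ≤ N :=
    ⟨T.sup Finsupp.degree, fun m hm => Finset.le_sup (f := Finsupp.degree) hm⟩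
  set Gv : A := ∑ m ∈ (Finsupp.finite_of_degree_le (σ := Fin n) N).toFinset,
    (∏ j, v j ^ m j) • G m with hGv
  have hGvmem : Gv ∈ Gr q := Submodule.sum_mem _ fun m _ => Submodule.smul_mem _ _ (hG m)
  -- F vanishes above degree N, so cF = xG may be summed over degrees ≤ N + 1; there the right side
  -- involves only G in degrees ≤ N.
  have hca : φ c * a = φ v * Gv := by
    have h1 : φ c * a = ∑ m ∈ T, (∏ i, v i ^ m i) • (φ c * F m) := by
      have h := congrArg (Subtype.val : ↥(Gr q ⊓ LinearMap.ker D) → A) hFa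
      rw [← show _ = a from h, AddSubmonoidClass.coe_finsetSum, Finset.mul_sum]
      exact Finset.sum_congr rfl fun m _ => mul_smul_comm _ _ _
    have h2 : φ c * a = ∑ m ∈ (Finsupp.finite_of_degree_le (σ := Fin n) (N + 1)).toFinset,
        (∏ i, v i ^ m i) • (φ c * F m) := by
      rw [h1]
      refine Finset.sum_subset (fun m hm => ?_) fun m _ hm => ?_
      · simp only [Set.Finite.mem_toFinset, Set.mem_ofPred_eq]
        exact (hN m hm).trans (Nat.le_succ N)
      · rw [hT m hm]; simp
    rw [h2, Finset.sum_congr rfl fun m _ => by rw [hFG m, Finset.smul_sum], Finset.sum_comm,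
      ← sum_smul_single φ v, Finset.sum_mul]
    refine Finset.sum_congr rfl fun i _ => ?_
    rw [sum_degree_le_smul_shift v N (fun m => φ (Pi.single i 1) * G m) i, hGv, smul_mul_assoc,
      Finset.mul_sum]
    simp only [mul_smul_comm]
  have hDGv : D Gv ∈ extendByZero Gr ((q : ℤ) - 1) :=
    H.boundary_mem_extendByZero (p := (q : ℤ)) hGvmem
  obtain ⟨s, hs, hsv⟩ := H.exists_sign hDGv
  -- Apply ∂ to ca = v G(v), using ∂a = 0 and v ∈ V̄.
  have ha' : a = -(φ v * D Gv) := by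
    rw [← H.boundary_mul_of_sumZero hv, ← hca, H.boundary_average_mul hn, hDa, mul_zero, sub_zero]
  refine ⟨-(s⁻¹ • D Gv), neg_mem (Submodule.smul_mem _ _ hDGv), ?_, ?_⟩
  · rw [map_neg, map_smul, H.boundary_boundary, smul_zero, neg_zero]
  · rw [neg_mul, smul_mul_assoc, hsv, smul_smul, inv_mul_cancel₀ hs, one_smul, ← ha']

variable {ψ : sumZero k n →ₗ[k] proj φ}

/-- With Ā = ker ∂, nonvanishing of the cohomology of Ā becomes a condition on elements of A. -/
lemma mem_projResonance_one_iff (H : IsBoundaryAlgebra φ Gr D) (hn : (n : k) ≠ 0)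
    (hψ : ∀ v, (ψ v : A) = φ v) {v : Fin n → k} {p : ℤ} :
    v ∈ projResonance Gr ψ p 1 ↔ v ∈ sumZero k n ∧ ∃ z ∈ extendByZero Gr p, D z = 0 ∧
      z * φ v = 0 ∧ ∀ y ∈ extendByZero Gr (p - 1), D y = 0 → y * φ v ≠ z := by
  have hψ' : ∀ (v : sumZero k n) (x : proj φ),
      ((rightMulAction ψ v x : proj φ) : A) = (x : A) * φ v := fun v x => by
    rw [mem_rightMulAction, MulMemClass.coe_mul, hψ]
  constructor
  · rintro ⟨v, hv, rfl⟩
    obtain ⟨z, hz, hz0, hz1⟩ := one_le_rank_cochainCohomology_iff.mp hv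
    refine ⟨v.2, z, mem_extendByZero_comap.mp hz, H.boundary_eq_zero_of_mem_proj z.2, ?_, ?_⟩
    · rw [← hψ', hz0]; rfl
    · intro y hy hDy hyz
      exact hz1 ⟨⟨y, (H.mem_proj_iff hn).mpr hDy⟩, mem_extendByZero_comap.mpr hy,
        Subtype.ext ((hψ' _ _).trans hyz)⟩
  · rintro ⟨hv, z, hz, hDz, hzv, h⟩
    refine ⟨⟨v, hv⟩, one_le_rank_cochainCohomology_iff.mpr
      ⟨⟨z, (H.mem_proj_iff hn).mpr hDz⟩, mem_extendByZero_comap.mpr hz,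
        Subtype.ext ((hψ' _ _).trans hzv), ?_⟩, rfl⟩
    rintro ⟨y, hy, hyz⟩
    exact h y (mem_extendByZero_comap.mp hy) (H.boundary_eq_zero_of_mem_proj y.2)
      (by rw [← hψ' ⟨v, hv⟩, hyz])

lemma projResonance_eq_empty_of_neg (H : IsBoundaryAlgebra φ Gr D) (hn : (n : k) ≠ 0)
    (hψ : ∀ v, (ψ v : A) = φ v) {p : ℤ} (hp : p < 0) : projResonance Gr ψ p 1 = ∅ := by
  refine Set.eq_empty_of_forall_notMem fun v hv => ?_
  obtain ⟨-, z, hz, -, -, h⟩ := (H.mem_projResonance_one_iff hn hψ).mp hv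
  exact h 0 (zero_mem _) (map_zero D)
    (by rw [zero_mul, eq_zero_of_mem_extendByZero hp hz])

/-- The projective subalgebra vanishes in the top degree. -/
lemma projResonance_eq_empty_of_gr_succ_eq_bot (H : IsBoundaryAlgebra φ Gr D) (hn : (n : k) ≠ 0)
    (hψ : ∀ v, (ψ v : A) = φ v) {l : ℕ} (hl : Gr (l + 1) = ⊥) :
    projResonance Gr ψ (l : ℤ) 1 = ∅ := by
  refine Set.eq_empty_of_forall_notMem fun v hv => ?_
  obtain ⟨-, z, hz, hDz, -, h⟩ := (H.mem_projResonance_one_iff hn hψ).mp hv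
  -- For z in ker ∂, z = ∂(cz), and cz vanishes by degree.
  have h0 : φ (average k n) * z ∈ Gr (l + 1) := H.mul_mem_gr l _ _ hz
  have h1 := H.boundary_average_mul hn z
  rw [hl, Submodule.mem_bot] at h0
  rw [h0, map_zero, hDz, mul_zero, sub_zero] at h1
  exact h 0 (zero_mem _) (map_zero D) (by rw [zero_mul, h1])

/-- For d = 1 one of the two depths is 0, which imposes no condition within V̄. -/
lemma resonance_one_eq_union (H : IsBoundaryAlgebra φ Gr D) (hn : (n : k) ≠ 0)
    (hψ : ∀ v, (ψ v : A) = φ v) (p : ℤ) :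
    resonance (extendByZero Gr) (rightMulAction φ) p 1 =
      projResonance Gr ψ p 1 ∪ projResonance Gr ψ (p - 1) 1 := by
  have h0 : ∀ (p : ℤ) (v : sumZero k n), (v : Fin n → k) ∈ projResonance Gr ψ p 0 := fun p v =>
    ⟨v, by simp [resonance], rfl⟩
  rw [H.resonance_eq hn hψ p le_rfl]
  ext v
  simp only [Set.mem_iUnion, Set.mem_inter_iff, Set.mem_union, exists_prop]
  constructor
  · rintro ⟨j, hj, h1, h2⟩
    interval_cases j
    · exact Or.inr h2
    · exact Or.inl h1
  · rintro (⟨w, hw, rfl⟩ | ⟨w, hw, rfl⟩)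
    · exact ⟨1, le_rfl, ⟨w, hw, rfl⟩, h0 _ w⟩
    · exact ⟨0, zero_le_one, h0 _ w, ⟨w, hw, rfl⟩⟩

/-- Resonance propagates in the projective subalgebra. -/
theorem projResonance_subset_succ (H : IsBoundaryAlgebra φ Gr D) [Module.Finite k A]
    (hn : (n : k) ≠ 0) (hψ : ∀ v, (ψ v : A) = φ v) {q : ℕ}
    (hgen : ∀ F : (Fin n →₀ ℕ) → A, (∀ m, F m ∈ Gr (q + 1)) →
      (∀ m, ∑ i, (if m i = 0 then 0 else
        φ (Pi.single i 1) * F (m - Finsupp.single i 1)) = 0) →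
      ∃ G : (Fin n →₀ ℕ) → A, (∀ m, G m ∈ Gr q) ∧
        ∀ m, F m = ∑ i, (if m i = 0 then 0 else
          φ (Pi.single i 1) * G (m - Finsupp.single i 1))) :
    projResonance Gr ψ (q : ℤ) 1 ⊆ projResonance Gr ψ (q + 1 : ℤ) 1 := by
  intro v hv
  rw [H.mem_projResonance_one_iff hn hψ] at hv ⊢
  obtain ⟨hv, z, hz, hDz, hzv, h⟩ := hv
  refine ⟨hv, ?_⟩
  by_contra! hcon
  obtain ⟨b, hb, hDb, hbz⟩ := H.exists_eq_mul_of_exact_succ hn hgen hv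
    (fun x hx hDx hxv => by
      obtain ⟨y, hy, hDy, hyx⟩ := hcon x hx hDx hxv
      rw [add_sub_cancel_right] at hy
      exact ⟨y, hy, hDy, hyx⟩) hz hDz hzv
  exact h b hb hDb hbz

end IsBoundaryAlgebra

end BoundaryAlgebra

/-! ### The Orlik-Solomon algebra as an algebra with boundary -/

noncomputable section OrlikSolomonBoundary

variable {k : Type*} [Field k] {n : ℕ} {M : Matroid (Fin n)}

lemma coordProj_univ : coordProj k (Set.univ : Set (Fin n)) = LinearMap.id :=
  LinearMap.ext fun v => Set.indicator_univ v

lemma partialBoundary_univ : partialBoundary k (Set.univ : Set (Fin n)) = extBoundary k n := by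
  rw [partialBoundary, coordProj_univ, LinearMap.comp_id]; rfl

lemma extRestrict_univ (x : ExteriorAlgebra k (Fin n → k)) : extRestrict k Set.univ x = x := by
  rw [extRestrict, coordProj_univ, ExteriorAlgebra.map_id]; rfl

lemma extBoundary_ι_mul (v : Fin n → k) (x : ExteriorAlgebra k (Fin n → k)) :
    extBoundary k n (ExteriorAlgebra.ι k v * x) =
      coordSum k n v • x - ExteriorAlgebra.ι k v * extBoundary k n x :=
  CliffordAlgebra.contractLeft_ι_mul _ _ _

instance (M : Matroid (Fin n)) : (osRelations k M).IsTwoSided :=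
  ⟨fun y hx => mul_right_mem_osRelations y hx⟩

/-- For a circuit C both ∂e_C and e_C = e_c ∂e_C (c the first element) lie in the ideal. Both
memberships survive prepending factors, since ∂(e_c y) = y - e_c ∂y. -/
lemma mem_osIdeal_of_circuit {C : Finset (Fin n)} (hC : M.IsCircuit ↑C) (R : List (Fin n)) :
    listMonomial k (R ++ C.sort (· ≤ ·)) ∈ osIdeal k M ∧
      extBoundary k n (listMonomial k (R ++ C.sort (· ≤ ·))) ∈ osIdeal k M := by
  induction R with
  | nil =>
    have h : extBoundary k n (listMonomial k (C.sort (· ≤ ·))) ∈ osIdeal k M :=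
      TwoSidedIdeal.subset_span ⟨C, hC, rfl⟩
    refine ⟨?_, h⟩
    rw [List.nil_append]
    cases hL : C.sort (· ≤ ·) with
    | nil =>
      obtain ⟨i, hi⟩ := hC.nonempty
      have : i ∈ C.sort (· ≤ ·) := (Finset.mem_sort _).mpr hi
      simp [hL] at this
    | cons c L =>
      rw [hL, ← partialBoundary_univ, listMonomial_cons,
        partialBoundary_extGen_mul_of_mem (Set.mem_univ c)] at h
      simpa [mul_sub] using (osIdeal k M).mul_mem_left (extGen k c) h
  | cons c R ih =>
    rw [List.cons_append, listMonomial_cons, ← partialBoundary_univ,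
      partialBoundary_extGen_mul_of_mem (Set.mem_univ c), partialBoundary_univ]
    exact ⟨Ideal.mul_mem_left _ _ ih.1, sub_mem ih.1 (Ideal.mul_mem_left _ _ ih.2)⟩

/-- The ideal generated by the boundaries of circuits contains the boundaries of all dependent
monomials. -/
lemma osIdeal_eq_osRelations (hM : M.E = Set.univ) : osIdeal k M = osRelations k M := by
  apply le_antisymm
  · have h : TwoSidedIdeal.span {x | ∃ C : Finset (Fin n), M.IsCircuit ↑C ∧
        x = extBoundary k n (extMonomial k C)} ≤ (osRelations k M).toTwoSided := by
      rw [TwoSidedIdeal.span_le]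
      rintro _ ⟨C, hC, rfl⟩
      rw [SetLike.mem_coe, Ideal.mem_toTwoSided, ← partialBoundary_univ, ← hM]
      refine partialBoundary_listMonomial_mem_osRelations (L := C.sort (· ≤ ·))
        (C.sort_nodup _) ?_
      have : {i | i ∈ C.sort (· ≤ ·)} = (C : Set (Fin n)) := by ext; simp
      rw [this]
      exact hC.dep
    intro x hx
    exact Ideal.mem_toTwoSided.mp (h hx)
  · intro x hx
    refine osRelations_le (K := (osIdeal k M).restrictScalars k) (fun i hi => ?_) ?_
      (fun i x hx => (osIdeal k M).mul_mem_left _ hx) hx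
    · exact absurd (hM ▸ Set.mem_univ i) hi
    · intro L hL hd
      obtain ⟨C, hCL, hC⟩ := hd.exists_isCircuit_subset
      obtain ⟨C, rfl⟩ := (Set.toFinite C).exists_finset_coe
      -- Up to sign, the circuit inside the dependent set may be moved to the end of the monomial.
      have hp : L.Perm (L.filter (· ∉ C) ++ C.sort (· ≤ ·)) := by
        rw [List.perm_ext_iff_of_nodup hL]
        · intro i
          have : i ∈ C → i ∈ L := fun hi => hCL hi
          simp only [List.mem_append, List.mem_filter, Finset.mem_sort, decide_eq_true_eq]
          tauto
        · refine (hL.filter _).append (C.sort_nodup _) ?_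
          intro i hi hi'
          simp only [List.mem_filter, decide_eq_true_eq, Finset.mem_sort] at hi hi'
          exact hi.2 hi'
      rw [hM]
      have h := (mem_osIdeal_of_circuit (k := k) hC (L.filter (· ∉ C))).2
      rw [← partialBoundary_univ] at h
      rcases partialBoundary_eq_or_neg_of_perm (k := k) Set.univ hp with h' | h' <;> rw [h']
      · exact h
      · exact neg_mem (S := Submodule k _) h

lemma boundary_mem_osIdeal (hM : M.E = Set.univ) {x : ExteriorAlgebra k (Fin n → k)}
    (hx : x ∈ osIdeal k M) : extBoundary k n x ∈ osIdeal k M := by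
  rw [osIdeal_eq_osRelations hM] at hx ⊢
  rw [← partialBoundary_univ, ← hM]
  exact partialBoundary_mem_osRelations hx

/-- The boundary of the Orlik-Solomon algebra. -/
def osBoundary (hM : M.E = Set.univ) : OSAlgebra k M →ₗ[k] OSAlgebra k M :=
  (((osIdeal k M).restrictScalars k).liftQ
    ((Ideal.Quotient.mkₐ k (osIdeal k M)).toLinearMap ∘ₗ extBoundary k n) fun _ hx =>
      Ideal.Quotient.eq_zero_iff_mem.mpr (boundary_mem_osIdeal hM hx)) ∘ₗ
  (Submodule.Quotient.restrictScalarsEquiv k (osIdeal k M)).symm.toLinearMap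

lemma osBoundary_mk (hM : M.E = Set.univ) (x : ExteriorAlgebra k (Fin n → k)) :
    osBoundary hM (Ideal.Quotient.mkₐ k (osIdeal k M) x) =
      Ideal.Quotient.mkₐ k (osIdeal k M) (extBoundary k n x) := rfl

lemma mkₐ_surjective : Function.Surjective (Ideal.Quotient.mkₐ k (osIdeal k M)) :=
  Ideal.Quotient.mkₐ_surjective k _

lemma osι_eq (v : Fin n → k) :
    osι k M v = Ideal.Quotient.mkₐ k (osIdeal k M) (ExteriorAlgebra.ι k v) := rfl

lemma isBoundaryAlgebra_osAlgebra (hM : M.E = Set.univ) :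
    IsBoundaryAlgebra (osι k M) (osPiece k M) (osBoundary hM) where
  boundary_mul v x := by
    obtain ⟨x, rfl⟩ := mkₐ_surjective x
    rw [osι_eq, ← map_mul, osBoundary_mk, extBoundary_ι_mul, osBoundary_mk, map_sub, map_smul,
      map_mul]
  boundary_one := by
    rw [← map_one (Ideal.Quotient.mkₐ k (osIdeal k M)), osBoundary_mk, ← partialBoundary_univ,
      partialBoundary_one, map_zero]
  boundary_boundary x := by
    obtain ⟨x, rfl⟩ := mkₐ_surjective x
    rw [osBoundary_mk, osBoundary_mk, ← partialBoundary_univ, partialBoundary_partialBoundary,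
      map_zero]
  sq_eq_zero v := by
    rw [osι_eq, ← map_mul, ExteriorAlgebra.ι_sq_zero, map_zero]
  mul_mem_gr p v x := by
    rintro ⟨x, hx, rfl⟩
    exact ⟨_, ι_mul_mem_extPow v hx, map_mul (Ideal.Quotient.mkₐ k (osIdeal k M)) _ _⟩
  boundary_mem p x := by
    rintro ⟨x, hx, rfl⟩
    refine ⟨_, ?_, (osBoundary_mk hM x).symm⟩
    rw [← partialBoundary_univ]
    exact partialBoundary_mem_extPow Set.univ hx (Nat.le_add_left 1 p)
  boundary_eq_zero x := by
    rintro ⟨x, hx, rfl⟩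
    rw [AlgHom.toLinearMap_apply, osBoundary_mk, ← partialBoundary_univ,
      partialBoundary_eq_zero_of_mem_extPow_zero _ hx, map_zero]
  supercomm p v x := by
    rintro ⟨x, hx, rfl⟩
    rw [AlgHom.toLinearMap_apply, osι_eq, ← map_mul, ← map_mul, mul_ι_of_mem_extPow v hx, map_smul]
  generated K h1 hK x := by
    obtain ⟨x, rfl⟩ := mkₐ_surjective x
    exact mem_of_extGen_mul_mem
      (K := K.comap (Ideal.Quotient.mkₐ k (osIdeal k M)).toLinearMap)
      ((congrArg (· ∈ K) (map_one (Ideal.Quotient.mkₐ k (osIdeal k M)))).mpr h1)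
      (fun i x hx => by
        have := hK (Pi.single i 1) _ hx
        rw [osι_eq, AlgHom.toLinearMap_apply, ← map_mul] at this
        exact this) x

lemma osPiece_eq_bot (hM : M.E = Set.univ) {p : ℕ} (hp : M.eRank < p) : osPiece k M p = ⊥ := by
  refine (Submodule.eq_bot_iff _).mpr ?_
  rintro _ ⟨x, hx, rfl⟩
  refine Ideal.Quotient.eq_zero_iff_mem.mpr ?_
  rw [osIdeal_eq_osRelations hM, ← extRestrict_univ x]
  refine extRestrict_mem_osRelations_of_eRk_lt (p := p) ?_ hx
  rwa [← hM, M.eRk_ground]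

instance : Module.Finite k (OSAlgebra k M) := by
  have : Module.Finite k (ExteriorAlgebra k (Fin n → k)) :=
    Module.Finite.of_basis (Pi.basisFun k (Fin n)).ExteriorAlgebra
  exact Module.Finite.of_surjective (Ideal.Quotient.mkₐ k (osIdeal k M)).toLinearMap
    mkₐ_surjective

lemma mkₐ_eq_zero_iff (hM : M.E = Set.univ) {x : ExteriorAlgebra k (Fin n → k)} :
    Ideal.Quotient.mkₐ k (osIdeal k M) x = 0 ↔ x ∈ osRelations k M := by
  rw [← osIdeal_eq_osRelations hM]
  exact Ideal.Quotient.eq_zero_iff_mem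

lemma mkₐ_genericMul (f : (Fin n →₀ ℕ) → ExteriorAlgebra k (Fin n → k)) (m : Fin n →₀ ℕ) :
    Ideal.Quotient.mkₐ k (osIdeal k M) (genericMul k Set.univ f m) =
      ∑ i, (if m i = 0 then 0 else osι k M (Pi.single i 1) *
        Ideal.Quotient.mkₐ k (osIdeal k M) (f (m - Finsupp.single i 1))) := by
  rw [genericMul_apply, map_sum]
  refine Finset.sum_congr (by ext; simp) fun i _ => ?_
  rw [varMul_apply, apply_ite (Ideal.Quotient.mkₐ k (osIdeal k M)), map_zero, map_mul]
  rfl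

/-- The complex of the generic vector over the Orlik-Solomon algebra is exact below the rank. -/
lemma exists_generic_primitive (hM : M.E = Set.univ) {q : ℕ}
    (hq : ((q + 2 : ℕ) : ℕ∞) ≤ M.eRank) (F : (Fin n →₀ ℕ) → OSAlgebra k M)
    (hF : ∀ m, F m ∈ osPiece k M (q + 1))
    (hF0 : ∀ m, ∑ i, (if m i = 0 then 0 else
      osι k M (Pi.single i 1) * F (m - Finsupp.single i 1)) = 0) :
    ∃ G : (Fin n →₀ ℕ) → OSAlgebra k M, (∀ m, G m ∈ osPiece k M q) ∧
      ∀ m, F m = ∑ i, (if m i = 0 then 0 else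
        osι k M (Pi.single i 1) * G (m - Finsupp.single i 1)) := by
  choose f hf hfF using hF
  obtain rfl : (fun m => Ideal.Quotient.mkₐ k (osIdeal k M) (f m)) = F := funext hfF
  obtain ⟨g, hg, hfg⟩ := genericExact (k := k) M (q + 1) hq f hf fun m => by
    rw [hM, ← mkₐ_eq_zero_iff hM, mkₐ_genericMul]
    exact hF0 m
  refine ⟨fun m => Ideal.Quotient.mkₐ k (osIdeal k M) (g m), fun m => ⟨_, hg m, rfl⟩, fun m => ?_⟩
  have := hfg m
  rw [hM, ← mkₐ_eq_zero_iff hM, map_sub, sub_eq_zero, mkₐ_genericMul] at this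
  exact this

end OrlikSolomonBoundary

/-! ### The main theorem. -/

theorem mainTheorem5 {k : Type*} [Field k] {n : ℕ} (M : Matroid (Fin n)) (hM : M.E = Set.univ)
    (l : ℕ) (hl : M.eRank = l) (hn : ¬ ringChar k ∣ n) :
    (∀ p : ℤ, 0 ≤ p → p ≤ (l : ℤ) - 1 → projOSResonance k M p 1 = osResonance k M p 1) ∧
    osResonance k M (l : ℤ) 1 = osResonance k M ((l : ℤ) - 1) 1 ∧
    (∀ (p : ℤ) (d : ℕ), 1 ≤ d →
      osResonance k M p d =
        ⋃ j : ℕ, ⋃ _ : j ≤ d, projOSResonance k M p j ∩ projOSResonance k M (p - 1) (d - j)) ∧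
    (∀ (p : ℤ) (d : ℕ),
      osResonance k M p d ∩ (sumZero k n : Set (Fin n → k)) =
        ⋃ j : ℕ, ⋃ _ : j ≤ d, projOSResonance k M p j ∩ projOSResonance k M (p - 1) (d - j)) := by
  have hn0 : (n : k) ≠ 0 := fun h => hn ((ringChar.spec k n).mp h)
  have H := isBoundaryAlgebra_osAlgebra (k := k) hM
  have hψ : ∀ v, (projOSι k M v : OSAlgebra k M) = osι k M v := fun _ => rfl
  have hunion : ∀ p : ℤ, osResonance k M p 1 =
      projOSResonance k M p 1 ∪ projOSResonance k M (p - 1) 1 :=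
    H.resonance_one_eq_union hn0 hψ
  have hneg : ∀ p : ℤ, p < 0 → projOSResonance k M p 1 = ∅ := fun p =>
    H.projResonance_eq_empty_of_neg hn0 hψ
  have htop : projOSResonance k M (l : ℤ) 1 = ∅ :=
    H.projResonance_eq_empty_of_gr_succ_eq_bot hn0 hψ
      (osPiece_eq_bot hM (by rw [hl]; exact_mod_cast Nat.lt_succ_self l))
  -- With p = q + 1, the bound p ≤ ℓ - 1 is q + 2 ≤ ℓ, exactly what generic exactness in degree q +
  -- 1 requires.
  have hprop : ∀ p : ℤ, p ≤ (l : ℤ) - 1 →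
      projOSResonance k M (p - 1) 1 ⊆ projOSResonance k M p 1 := by
    intro p hp
    rcases lt_or_ge (p - 1) 0 with h | h
    · rw [hneg _ h]; exact Set.empty_subset _
    · obtain ⟨q, hq⟩ := Int.eq_ofNat_of_zero_le h
      obtain rfl : p = (q : ℤ) + 1 := by omega
      rw [add_sub_cancel_right]
      exact H.projResonance_subset_succ hn0 hψ (exists_generic_primitive hM (by
        rw [hl]; exact_mod_cast (by omega : q + 2 ≤ l)))
  have hlow : ∀ p : ℤ, p ≤ (l : ℤ) - 1 → projOSResonance k M p 1 = osResonance k M p 1 :=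
    fun p hp => by rw [hunion, Set.union_eq_left.mpr (hprop p hp)]
  refine ⟨fun p _ => hlow p, ?_, fun p d => H.resonance_eq hn0 hψ p,
    fun p d => H.resonance_inter_eq hn0 hψ p d⟩
  -- Only R^{ℓ-1}(Ā) remains in degree ℓ, and it equals R^{ℓ-1}(A). `hlow` has no lower bound on p,
  -- so ℓ = 0 is included.
  rw [hunion, htop, Set.empty_union, hlow _ le_rfl]
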